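/- Let $C_1\in\{1,-1\}$, $C_2>0$ and $\varphi\in H^1(\mathbb R)$ (complex-valued). For an interval $I\subset\mathbb R$ with $0\in I$, an $H^1$-solution on $I$ of $$ i v_z+v_{tt}+C_1e^{-C_2z}|v|^2v=0,\qquad v(0)=\varphi, \tag{$*$}$$ is a function $v\in C(I,H^1(\mathbb R))\cap C^1(I,H^{-1}(\mathbb R))$, where $H^{-1}(\mathbb R)$ is the dual of $H^1(\mathbb R)$, such that $v(0)=\varphi$ in $H^1(\mathbb R)$ and the equation holds in $H^{-1}(\mathbb R)$ for every $z\in I$. Then the $H^1$-solution of $(*)$ exists for every $z\in\mathbb R$: there is an $H^1$-solution $v$ of $(*)$ on $I=\mathbb R$, and every $H^1$-solution of $(*)$ on an interval $I\ni 0$ (for example on $[0,\infty)$ or $[0,Z]$) coincides with $v$ on $I$. -/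

import Mathlib

open MeasureTheory Set

noncomputable section

/-- Complex-valued `L²(ℝ)` with Lebesgue measure. -/
abbrev L2R : Type := Lp ℂ 2 (volume : Measure ℝ)

/-- `u'` is the weak derivative of `u`: `∫ u' χ = -∫ u χ'` for all test functions `χ ∈ C¹_c(ℝ)`. -/
def IsWeakDeriv (u u' : ℝ → ℂ) : Prop :=
  ∀ χ : ℝ → ℂ, ContDiff ℝ 1 χ → HasCompactSupport χ →
    ∫ t, u' t * χ t = -∫ t, u t * deriv χ t

theorem L2R.integrable_mul_test (f : L2R) {χ : ℝ → ℂ} (hχ : Continuous χ)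
    (hs : HasCompactSupport χ) : Integrable (fun t => f t * χ t) :=
  MemLp.integrable_mul (p := 2) (q := 2) (Lp.memLp f) (hχ.memLp_of_hasCompactSupport hs)

/-- The subspace of `L² × L²` (with its Hilbert norm) of pairs `(u, u')` such that `u'` is the weak
derivative of `u`. -/
def h1Submodule : Submodule ℂ (WithLp 2 (L2R × L2R)) where
  carrier := {p | IsWeakDeriv p.fst p.snd}
  zero_mem' := by
    intro χ _ _
    simp
  add_mem' := by
    intro p q hp hq χ hχ hs
    have hd := hχ.continuous_deriv le_rfl
    have e1 : ∫ t, (p.snd + q.snd : L2R) t * χ t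
        = (∫ t, p.snd t * χ t) + ∫ t, q.snd t * χ t := by
      rw [← integral_add (L2R.integrable_mul_test _ hχ.continuous hs)
        (L2R.integrable_mul_test _ hχ.continuous hs)]
      refine integral_congr_ae ?_
      filter_upwards [Lp.coeFn_add p.snd q.snd] with t ht
      rw [ht, Pi.add_apply, add_mul]
    have e2 : ∫ t, (p.fst + q.fst : L2R) t * deriv χ t
        = (∫ t, p.fst t * deriv χ t) + ∫ t, q.fst t * deriv χ t := by
      rw [← integral_add (L2R.integrable_mul_test _ hd hs.deriv)
        (L2R.integrable_mul_test _ hd hs.deriv)]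
      refine integral_congr_ae ?_
      filter_upwards [Lp.coeFn_add p.fst q.fst] with t ht
      rw [ht, Pi.add_apply, add_mul]
    change ∫ t, (p.snd + q.snd : L2R) t * χ t = -∫ t, (p.fst + q.fst : L2R) t * deriv χ t
    rw [e1, e2, hp χ hχ hs, hq χ hχ hs, neg_add]
  smul_mem' := by
    intro c p hp χ hχ hs
    have e : ∀ (f : L2R) (ψ : ℝ → ℂ), ∫ t, (c • f : L2R) t * ψ t = c * ∫ t, f t * ψ t := by
      intro f ψ
      rw [← integral_const_mul]
      refine integral_congr_ae ?_
      filter_upwards [Lp.coeFn_smul c f] with t ht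
      rw [ht, Pi.smul_apply, smul_eq_mul, mul_assoc]
    change ∫ t, (c • p.snd : L2R) t * χ t = -∫ t, (c • p.fst : L2R) t * deriv χ t
    rw [e, e, hp χ hχ hs, mul_neg]

/-- The Sobolev space `H¹(ℝ) = W^{1,2}(ℝ)`: functions `u ∈ L²` with a weak derivative `u' ∈ L²`,
each recorded together with its (unique) weak derivative, with the Hilbert norm
`‖u‖²_{H¹} = ‖u‖²_{L²} + ‖u'‖²_{L²}`. -/
def H1R : Type := h1Submodule

namespace H1R

instance : NormedAddCommGroup H1R := inferInstanceAs (NormedAddCommGroup h1Submodule)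

instance : InnerProductSpace ℂ H1R := inferInstanceAs (InnerProductSpace ℂ h1Submodule)

/-- The isometric inclusion `u ↦ (u, u')` of `H¹(ℝ)` into `L² × L²`. -/
def toPair : H1R →ₗᵢ[ℂ] WithLp 2 (L2R × L2R) := h1Submodule.subtypeₗᵢ

/-- The inclusion `H¹(ℝ) → L²(ℝ)`. -/
def toL2 : H1R →L[ℂ] L2R :=
  (WithLp.fstL 2 ℂ L2R L2R).comp toPair.toContinuousLinearMap

/-- The weak derivative `u ↦ u_t`, as a map `H¹(ℝ) → L²(ℝ)`. -/
def weakDeriv : H1R →L[ℂ] L2R :=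
  (WithLp.sndL 2 ℂ L2R L2R).comp toPair.toContinuousLinearMap

end H1R

/-- `H⁻¹(ℝ)`, the dual space of `H¹(ℝ)`. -/
abbrev HNeg1R : Type := StrongDual ℂ H1R

/-- The bilinear pairing `(f, g) ↦ ∫ f g` on `L²(ℝ)`. -/
def pairL2 : L2R →L[ℂ] L2R →L[ℂ] ℂ := (ContinuousLinearMap.mul ℂ ℂ).lpPairing volume 2 2

namespace HNeg1R

/-- The inclusion `L²(ℝ) → H⁻¹(ℝ)`, `f ↦ (w ↦ ∫ f w)`. -/
def ofL2 (f : L2R) : HNeg1R := (pairL2 f).comp H1R.toL2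

/-- The inclusion `H¹(ℝ) → H⁻¹(ℝ)`. -/
def ofH1 (u : H1R) : HNeg1R := ofL2 (H1R.toL2 u)

end HNeg1R

/-- The second derivative `H¹(ℝ) → H⁻¹(ℝ)`, `u ↦ u_tt = (w ↦ -∫ u_t w_t)`. -/
def H1R.secondDeriv (u : H1R) : HNeg1R := -(pairL2 (H1R.weakDeriv u)).comp H1R.weakDeriv

/-- `v` is an `H¹`-solution on the interval `I ∋ 0` of
`i v_z + v_tt + C₁ e^{-C₂ z} |v|² v = 0`, `v(0) = φ`: the function `v` lies in
`C(I, H¹) ∩ C¹(I, H⁻¹)`, it takes the initial value in `H¹`, and the equation holds in `H⁻¹`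
(that is, tested against every `w ∈ H¹`) for every `z ∈ I`. At endpoints of `I` that belong to `I` the derivative is one-sided. -/
structure IsH1Solution (C₁ C₂ : ℝ) (φ : H1R) (I : Set ℝ) (v : ℝ → H1R) : Prop where
  continuousOn : ContinuousOn v I
  initial : v 0 = φ
  /-- `vz` is the `H⁻¹`-valued derivative of `v`; `N` is the class in `L²` of the nonlinear term
  at `z`. -/
  equation : ∃ vz : ℝ → HNeg1R, ContinuousOn vz I ∧ ∀ z ∈ I,
    HasDerivWithinAt (fun s => HNeg1R.ofH1 (v s)) (vz z) I z ∧
    ∃ N : L2R,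
      (∀ᵐ t : ℝ, N t = (C₁ * Real.exp (-C₂ * z) : ℝ) *
        ((‖H1R.toL2 (v z) t‖ ^ 2 : ℝ) * H1R.toL2 (v z) t)) ∧
      ∀ w : H1R, Complex.I * vz z w + H1R.secondDeriv (v z) w + HNeg1R.ofL2 N w = 0

end

open scoped FourierTransform SchwartzMap ContDiff Topology ComplexConjugate
open Filter

noncomputable section

/-! In one dimension `|u|² ≤ 2 ‖u‖ ‖u_t‖` (norms in `L²`; `H1R.ae_norm_sq_le`), so `H¹` is an
algebra and `u ↦ |u|²u` is locally Lipschitz on it. The Fourier transform turns `∂_t` into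
multiplication by `2πiξ`; hence the free group `S(z)`, with symbol `e^{-4π²iξ²z}`, is isometric on
`H¹`. In the interaction picture `y(z) = S(-z)v(z)` the equation becomes an ordinary differential
equation in `H¹` with a locally Lipschitz field, and a solution `y` of it gives an `H¹`-solution
`v`. Truncating the nonlinearity outside a ball of radius `R` makes the field globally Lipschitz, so
Picard–Lindelöf applies on all of `[-T, T]`.

The truncation is removed by a bound independent of `R` (`norm_sq_le_aprioriBound`). The mass `‖v‖²`
does not grow. With `c(z) = C₁e^{-C₂z}`, the energy `‖v_t‖² - (c/2)∫|v|⁴` changes only through the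
explicit dependence of `c` on `z`, at rate `(C₂/2) c ∫|v|⁴`. By Gagliardo–Nirenberg and the mass
bound, `|c| ∫|v|⁴ ≤ ‖v_t‖² + const` on `[-T, T]`, so for either sign of `C₁` Grönwall bounds
`‖v_t‖`. A continuity argument keeps `y` inside a sufficiently large ball.

Uniqueness needs only the given regularity: the difference of two solutions is paired with its own
conjugate in `H⁻¹ × H¹`, the dispersive term drops out, and Grönwall in `L²` makes the difference
vanish. It also lets the solutions on the intervals `[-n, n]` be glued. -/

/-- Complex conjugation on `L²(ℝ)`, as a conjugate-linear map. -/
def conjL2 : L2R →L⋆[ℂ] L2R :=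
  ((starL ℂ : ℂ ≃L⋆[ℂ] ℂ) : ℂ →L⋆[ℂ] ℂ).compLpL 2 volume

theorem coeFn_conjL2 (f : L2R) : ∀ᵐ t, conjL2 f t = conj (f t) :=
  ContinuousLinearMap.coeFn_compLpL _ f

@[simp] theorem norm_conjL2 (f : L2R) : ‖conjL2 f‖ = ‖f‖ := by
  apply le_antisymm <;> apply Lp.norm_le_norm_of_ae_le <;>
    filter_upwards [coeFn_conjL2 f] with t ht <;> simp [ht]

@[simp] theorem conjL2_conjL2 (f : L2R) : conjL2 (conjL2 f) = f := by
  refine Lp.ext ?_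
  filter_upwards [coeFn_conjL2 f, coeFn_conjL2 (conjL2 f)] with t h1 h2
  simp [h2, h1]

theorem pairL2_apply (f g : L2R) : pairL2 f g = ∫ t, f t * g t := by
  simp [pairL2, ContinuousLinearMap.lpPairing_eq_integral]

theorem pairL2_comm (f g : L2R) : pairL2 f g = pairL2 g f := by
  simp only [pairL2_apply, mul_comm]

theorem inner_eq_integral (f g : L2R) : inner ℂ f g = ∫ t, conj (f t) * g t := by
  rw [L2.inner_def]
  simp [mul_comm]

theorem inner_eq_pairL2 (f g : L2R) : inner ℂ f g = pairL2 (conjL2 f) g := by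
  rw [inner_eq_integral, pairL2_apply]
  refine integral_congr_ae ?_
  filter_upwards [coeFn_conjL2 f] with t ht
  rw [ht]

theorem pairL2_eq_inner (f g : L2R) : pairL2 f g = inner ℂ (conjL2 f) g := by
  rw [inner_eq_pairL2, conjL2_conjL2]

theorem pairL2_conjL2 (f g : L2R) : pairL2 f (conjL2 g) = inner ℂ g f := by
  rw [inner_eq_pairL2, pairL2_comm]

theorem L2R.integrable_mul (f : L2R) {g : ℝ → ℂ} (hg : MemLp g 2) :
    Integrable (fun t => f t * g t) :=
  MemLp.integrable_mul (p := 2) (q := 2) (Lp.memLp f) hg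

/-! ### Weak derivatives and their Fourier characterization -/

/-- Integration by parts for a weakly differentiable function against a `C¹` function which is
square integrable together with its derivative, but not necessarily compactly supported. -/
theorem IsWeakDeriv.integral_mul {u w : L2R} (h : IsWeakDeriv u w) {χ : ℝ → ℂ}
    (hχ : ContDiff ℝ 1 χ) (h0 : MemLp χ 2) (h1 : MemLp (deriv χ) 2) :
    ∫ t, w t * χ t = -∫ t, u t * deriv χ t := by
  -- Cut `χ` off by the dilated bump `η(r_n t)` with `r_n = 1/(n+1)`. The extra term `r_n η'(r_n t)
  -- χ` in the derivative vanishes in the limit, and everything is dominated.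
  let b : ContDiffBump (0 : ℝ) := ⟨1, 2, one_pos, one_lt_two⟩
  let η : ℝ → ℂ := fun t => (b t : ℂ)
  have hη : ContDiff ℝ 1 η := Complex.ofRealCLM.contDiff.comp b.contDiff
  have hηs : HasCompactSupport η := b.hasCompactSupport.comp_left (g := Complex.ofReal) (by simp)
  have hηle : ∀ t, ‖η t‖ ≤ 1 := fun t => by
    simp only [η, Complex.norm_real, Real.norm_eq_abs, abs_of_nonneg b.nonneg]
    exact b.le_one
  have hη1 : ∀ t : ℝ, |t| ≤ 1 → η t = 1 := fun t ht => by
    simp only [η]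
    rw [b.one_of_mem_closedBall (by simpa [Metric.mem_closedBall, b] using ht)]
    simp
  obtain ⟨C, hC⟩ := (hηs.deriv.exists_bound_of_continuous (hη.continuous_deriv le_rfl))
  let r : ℕ → ℝ := fun n => ((n : ℝ) + 1)⁻¹
  have hr0 : ∀ n, 0 < r n := fun n => by positivity
  have hr1 : ∀ n, r n ≤ 1 := fun n => inv_le_one_of_one_le₀ (by simp)
  have hrt : Tendsto r atTop (𝓝 0) := by
    simpa [r, one_div] using tendsto_one_div_add_atTop_nhds_zero_nat (𝕜 := ℝ)
  let χn : ℕ → ℝ → ℂ := fun n t => η (r n * t) * χ t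
  have hcn : ∀ n, ContDiff ℝ 1 (fun t => η (r n * t)) := fun n =>
    hη.comp (contDiff_const.mul contDiff_id)
  have hsn : ∀ n, HasCompactSupport (fun t => η (r n * t)) := fun n => by
    have := hηs.comp_homeomorph (Homeomorph.mulLeft₀ (r n) (hr0 n).ne')
    exact this
  have hd : ∀ n t, deriv (χn n) t = r n * deriv η (r n * t) * χ t + η (r n * t) * deriv χ t := by
    intro n t
    have e1 : HasDerivAt (fun t => η (r n * t)) (r n * deriv η (r n * t)) t := by
      have := ((hη.differentiable one_ne_zero (r n * t)).hasDerivAt).scomp t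
        ((hasDerivAt_id t).const_mul (r n))
      simpa [Function.comp_def] using this
    exact (e1.mul (hχ.differentiable one_ne_zero t).hasDerivAt).deriv
  have key : ∀ n, ∫ t, w t * χn n t = -∫ t, u t * deriv (χn n) t := fun n =>
    h _ ((hcn n).mul hχ) ((hsn n).mul_right)
  have hev : ∀ t : ℝ, ∀ᶠ n in atTop, |r n * t| ≤ 1 := by
    intro t
    have : Tendsto (fun n => |r n * t|) atTop (𝓝 0) := by
      simpa using (hrt.mul_const t).abs
    exact (this.eventually (gt_mem_nhds one_pos)).mono fun n hn => hn.le
  have hηt : ∀ t, Tendsto (fun n => η (r n * t)) atTop (𝓝 1) := fun t =>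
    tendsto_const_nhds.congr' ((hev t).mono fun n hn => (hη1 _ hn).symm)
  have l1 : Tendsto (fun n => ∫ t, w t * χn n t) atTop (𝓝 (∫ t, w t * χ t)) := by
    refine tendsto_integral_of_dominated_convergence (fun t => ‖w t * χ t‖) ?_
      (L2R.integrable_mul w h0).norm ?_ ?_
    · intro n
      exact (Lp.aestronglyMeasurable w).mul
        (((hcn n).mul hχ).continuous.aestronglyMeasurable)
    · intro n
      refine Eventually.of_forall fun t => ?_
      rw [norm_mul, norm_mul, norm_mul]
      have := mul_le_mul_of_nonneg_right (hηle (r n * t)) (norm_nonneg (χ t))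
      rw [one_mul] at this
      gcongr
    · refine Eventually.of_forall fun t => ?_
      simpa [χn] using ((hηt t).mul_const (χ t)).const_mul (w t)
  have l2 : Tendsto (fun n => ∫ t, u t * deriv (χn n) t) atTop (𝓝 (∫ t, u t * deriv χ t)) := by
    refine tendsto_integral_of_dominated_convergence
      (fun t => C * ‖u t * χ t‖ + ‖u t * deriv χ t‖) ?_
      (((L2R.integrable_mul u h0).norm.const_mul C).add (L2R.integrable_mul u h1).norm) ?_ ?_
    · intro n
      exact (Lp.aestronglyMeasurable u).mul
        ((((hcn n).mul hχ).continuous_deriv le_rfl).aestronglyMeasurable)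
    · intro n
      refine Eventually.of_forall fun t => ?_
      rw [hd, mul_add]
      refine (norm_add_le _ _).trans (add_le_add ?_ ?_)
      · simp only [norm_mul, Complex.norm_real, Real.norm_eq_abs, abs_of_pos (hr0 n)]
        have h3 := mul_le_mul (hr1 n) (hC (r n * t)) (norm_nonneg _) zero_le_one
        calc ‖u t‖ * (r n * ‖deriv η (r n * t)‖ * ‖χ t‖)
            ≤ ‖u t‖ * (1 * C * ‖χ t‖) := by gcongr
          _ = C * (‖u t‖ * ‖χ t‖) := by ring
      · rw [norm_mul, norm_mul, norm_mul]
        have := mul_le_mul_of_nonneg_right (hηle (r n * t)) (norm_nonneg (deriv χ t))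
        rw [one_mul] at this
        gcongr
    · refine Eventually.of_forall fun t => ?_
      simp only [hd]
      have z : Tendsto (fun n => (r n : ℂ) * deriv η (r n * t)) atTop (𝓝 0) := by
        rw [tendsto_zero_iff_norm_tendsto_zero]
        refine squeeze_zero (fun _ => norm_nonneg _) (fun n => ?_) (by simpa using hrt.mul_const C)
        rw [norm_mul, Complex.norm_real, Real.norm_eq_abs, abs_of_pos (hr0 n)]
        exact mul_le_mul_of_nonneg_left (hC _) (hr0 n).le
      simpa using (((z.mul_const (χ t)).add ((hηt t).mul_const (deriv χ t))).const_mul (u t))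
  have l3 := l2.neg
  simp only [← key] at l3
  exact tendsto_nhds_unique l1 l3

/-- A square integrable `C¹` function with square integrable derivative is weakly
differentiable. -/
theorem isWeakDeriv_of_contDiff {f : ℝ → ℂ} (hf : ContDiff ℝ 1 f) (h0 : MemLp f 2)
    (h1 : MemLp (deriv f) 2) : IsWeakDeriv (h0.toLp f) (h1.toLp (deriv f)) := by
  intro χ hχ hs
  have hχ0 : MemLp χ 2 := hχ.continuous.memLp_of_hasCompactSupport hs
  have hχ1 : MemLp (deriv χ) 2 :=
    (hχ.continuous_deriv le_rfl).memLp_of_hasCompactSupport hs.deriv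
  have e1 : ∫ t, h1.toLp (deriv f) t * χ t = ∫ t, deriv f t * χ t := by
    refine integral_congr_ae ?_
    filter_upwards [h1.coeFn_toLp] with t ht
    rw [ht]
  have e2 : ∫ t, h0.toLp f t * deriv χ t = ∫ t, f t * deriv χ t := by
    refine integral_congr_ae ?_
    filter_upwards [h0.coeFn_toLp] with t ht
    rw [ht]
  rw [e1, e2, eq_neg_iff_add_eq_zero, add_comm, ← eq_neg_iff_add_eq_zero]
  exact integral_mul_deriv_eq_deriv_mul_of_integrable
    (fun t _ => (hf.differentiable one_ne_zero t).hasDerivAt)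
    (fun t _ => (hχ.differentiable one_ne_zero t).hasDerivAt)
    (MemLp.integrable_mul (p := 2) (q := 2) h0 hχ1)
    (MemLp.integrable_mul (p := 2) (q := 2) h1 hχ0)
    (MemLp.integrable_mul (p := 2) (q := 2) h0 hχ0)

theorem fourier_derivCLM_apply (f : 𝓢(ℝ, ℂ)) (ξ : ℝ) :
    𝓕 (SchwartzMap.derivCLM ℂ ℂ f) ξ = (2 * Real.pi * Complex.I * ξ) * 𝓕 f ξ := by
  have h := Real.fourier_deriv (f := f) f.integrable f.differentiable
    (SchwartzMap.derivCLM ℂ ℂ f).integrable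
  have h' := congrFun h ξ
  rw [SchwartzMap.fourier_coe, SchwartzMap.fourier_coe]
  exact h'

theorem inner_toLp_left (f : 𝓢(ℝ, ℂ)) (g : L2R) :
    inner ℂ (f.toLp 2) g = ∫ t, conj (f t) * g t := by
  rw [inner_eq_integral]
  refine integral_congr_ae ?_
  filter_upwards [f.coeFn_toLp 2 volume] with t ht
  rw [ht]

theorem L2R.locallyIntegrable (f : L2R) : LocallyIntegrable f :=
  (Lp.memLp f).locallyIntegrable (by norm_num)

theorem L2R.locallyIntegrable_mul {m : ℝ → ℂ} (hm : Continuous m) (f : L2R) :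
    LocallyIntegrable (fun ξ => m ξ * f ξ) := by
  have := (L2R.locallyIntegrable f).locallyIntegrableOn univ
  rw [← locallyIntegrableOn_univ]
  exact LocallyIntegrableOn.continuousOn_smul (g := m) isOpen_univ.isLocallyClosed this
    hm.continuousOn

/-- The Fourier symbol of the derivative. -/
def derivSymbol (ξ : ℝ) : ℂ := 2 * Real.pi * Complex.I * ξ

theorem continuous_derivSymbol : Continuous derivSymbol := by
  unfold derivSymbol; fun_prop

theorem conj_derivSymbol (ξ : ℝ) : conj (derivSymbol ξ) = -derivSymbol ξ := by
  simp [derivSymbol, Complex.conj_ofNat]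

/-- A frequency-side test function `g` is the transform of a Schwartz function `f`, so Plancherel
reduces the claim to integration by parts against `conj f`. As `f` need not have compact support,
`IsWeakDeriv.integral_mul` is required. -/
theorem IsWeakDeriv.fourier {u w : L2R} (h : IsWeakDeriv u w) :
    ∀ᵐ ξ, (𝓕 w : L2R) ξ = derivSymbol ξ * (𝓕 u : L2R) ξ := by
  refine ae_eq_of_integral_contDiff_smul_eq (L2R.locallyIntegrable _)
    (L2R.locallyIntegrable_mul continuous_derivSymbol _) fun g hg hgs => ?_
  have hG : ContDiff ℝ ∞ (fun t => (g t : ℂ)) := Complex.ofRealCLM.contDiff.comp hg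
  have hGs : HasCompactSupport (fun t => (g t : ℂ)) :=
    hgs.comp_left (g := Complex.ofReal) (by simp)
  set G : 𝓢(ℝ, ℂ) := hGs.toSchwartzMap hG with hGdef
  have hGa : ∀ t, G t = (g t : ℂ) := fun t => rfl
  set f : 𝓢(ℝ, ℂ) := 𝓕⁻ G
  have hfG : 𝓕 f = G := FourierTransform.fourier_fourierInv_eq G
  set f' := SchwartzMap.derivCLM ℂ ℂ f
  have e1 : ∫ ξ, g ξ • (𝓕 w : L2R) ξ = inner ℂ (f.toLp 2) w := by
    rw [← Lp.inner_fourier_eq, SchwartzMap.toLp_fourier_eq, inner_toLp_left, hfG]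
    simp [hGa]
  have e2 : ∫ ξ, g ξ • (derivSymbol ξ * (𝓕 u : L2R) ξ) = -inner ℂ (f'.toLp 2) u := by
    rw [← Lp.inner_fourier_eq, SchwartzMap.toLp_fourier_eq, inner_toLp_left, ← integral_neg]
    congr 1 with ξ
    rw [fourier_derivCLM_apply, hfG, hGa, map_mul]
    change _ = -(conj (derivSymbol ξ) * _ * _)
    rw [conj_derivSymbol]
    simp
    ring
  have hc : ContDiff ℝ 1 (fun t => conj (f t)) := Complex.conjCLE.contDiff.comp (f.smooth 1)
  have hcd : deriv (fun t => conj (f t)) = fun t => conj (f' t) := by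
    ext t
    exact ((f.differentiable t).hasDerivAt.star).deriv
  rw [e1, e2, inner_toLp_left, inner_toLp_left]
  have := h.integral_mul hc (f.memLp 2 volume).star (by rw [hcd]; exact (f'.memLp 2 volume).star)
  simp only [hcd] at this
  simpa only [mul_comm] using this

/-- By Plancherel both sides become frequency integrals. The transform of `conj χ` obeys the same
symbol relation, and the minus sign comes from the symbol being purely imaginary. -/
theorem isWeakDeriv_of_fourier {u w : L2R}
    (h : ∀ᵐ ξ, (𝓕 w : L2R) ξ = derivSymbol ξ * (𝓕 u : L2R) ξ) : IsWeakDeriv u w := by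
  intro χ hχ hs
  have hc : ContDiff ℝ 1 (fun t => conj (χ t)) := Complex.conjCLE.contDiff.comp hχ
  have hcd : deriv (fun t => conj (χ t)) = fun t => conj (deriv χ t) := by
    ext t
    exact ((hχ.differentiable one_ne_zero t).hasDerivAt.star).deriv
  have h0 : MemLp (fun t => conj (χ t)) 2 := (hχ.continuous.memLp_of_hasCompactSupport hs).star
  have h1 : MemLp (deriv (fun t => conj (χ t))) 2 := by
    rw [hcd]
    exact ((hχ.continuous_deriv le_rfl).memLp_of_hasCompactSupport hs.deriv).star
  have hf := (isWeakDeriv_of_contDiff hc h0 h1).fourier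
  have e1 : ∫ t, w t * χ t = inner ℂ (h0.toLp _) w := by
    rw [inner_eq_integral]
    refine integral_congr_ae ?_
    filter_upwards [h0.coeFn_toLp] with t ht
    rw [ht]; simp [mul_comm]
  have e2 : ∫ t, u t * deriv χ t = inner ℂ (h1.toLp _) u := by
    rw [inner_eq_integral]
    refine integral_congr_ae ?_
    filter_upwards [h1.coeFn_toLp] with t ht
    rw [ht, hcd]; simp [mul_comm]
  rw [e1, e2, ← Lp.inner_fourier_eq (h0.toLp _), ← Lp.inner_fourier_eq (h1.toLp _), inner_eq_integral, inner_eq_integral,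
    ← integral_neg]
  refine integral_congr_ae ?_
  filter_upwards [h, hf] with ξ h2 h3
  rw [h2, h3, map_mul, conj_derivSymbol]
  ring

/-! ### Norm, extensionality and completeness of `H¹` -/

/-- The element of `H¹(ℝ)` given by a function and its weak derivative. -/
def H1R.mk (u w : L2R) (h : IsWeakDeriv u w) : H1R := (⟨WithLp.toLp 2 (u, w), h⟩ : h1Submodule)

@[simp] theorem H1R.toL2_mk (u w : L2R) (h : IsWeakDeriv u w) : (H1R.mk u w h).toL2 = u := rfl

@[simp] theorem H1R.weakDeriv_mk (u w : L2R) (h : IsWeakDeriv u w) :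
    (H1R.mk u w h).weakDeriv = w := rfl

theorem H1R.isWeakDeriv (u : H1R) : IsWeakDeriv u.toL2 u.weakDeriv := Subtype.property u

theorem H1R.inner_eq (u v : H1R) :
    inner ℂ u v = inner ℂ u.toL2 v.toL2 + inner ℂ u.weakDeriv v.weakDeriv :=
  WithLp.prod_inner_apply _ _

theorem H1R.norm_sq_eq (u : H1R) : ‖u‖ ^ 2 = ‖u.toL2‖ ^ 2 + ‖u.weakDeriv‖ ^ 2 :=
  WithLp.prod_norm_sq_eq_of_L2 _

theorem H1R.fourier_weakDeriv (u : H1R) :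
    ∀ᵐ ξ, (𝓕 u.weakDeriv : L2R) ξ = derivSymbol ξ * (𝓕 u.toL2 : L2R) ξ := u.isWeakDeriv.fourier

/-- The transform of the weak derivative is determined by that of the function. Identities in `H¹`
can therefore be checked on the `L²` component alone. -/
theorem H1R.ext_toL2 {u v : H1R} (h : u.toL2 = v.toL2) : u = v := by
  have hd : u.weakDeriv = v.weakDeriv := by
    apply (Lp.fourierTransformₗᵢ ℝ ℂ).injective
    refine Lp.ext ?_
    filter_upwards [u.fourier_weakDeriv, v.fourier_weakDeriv] with ξ h1 h2
    change (𝓕 u.weakDeriv : L2R) ξ = (𝓕 v.weakDeriv : L2R) ξ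
    rw [h1, h2, h]
  exact Subtype.ext (WithLp.ofLp_injective 2 (Prod.ext h hd))

theorem H1R.norm_toL2_le (u : H1R) : ‖u.toL2‖ ≤ ‖u‖ := by
  refine abs_le_of_sq_le_sq' ?_ (norm_nonneg _) |>.2
  rw [u.norm_sq_eq]; linarith [sq_nonneg ‖u.weakDeriv‖]

theorem H1R.norm_weakDeriv_le (u : H1R) : ‖u.weakDeriv‖ ≤ ‖u‖ := by
  refine abs_le_of_sq_le_sq' ?_ (norm_nonneg _) |>.2
  rw [u.norm_sq_eq]; linarith [sq_nonneg ‖u.toL2‖]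

/-- Each test function imposes one equation between continuous functionals of the pair. Closedness
gives the completeness of `H¹` that Picard–Lindelöf needs. -/
theorem isClosed_h1Submodule : IsClosed (h1Submodule : Set (WithLp 2 (L2R × L2R))) := by
  have key : (h1Submodule : Set (WithLp 2 (L2R × L2R))) =
      ⋂ (χ : ℝ → ℂ) (hχ : ContDiff ℝ 1 χ) (hs : HasCompactSupport χ),
        {p | pairL2 p.snd ((hχ.continuous.memLp_of_hasCompactSupport hs).toLp χ) =
          -pairL2 p.fst (((hχ.continuous_deriv le_rfl).memLp_of_hasCompactSupport
            hs.deriv).toLp (deriv χ))} := by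
    ext p
    simp only [mem_iInter]
    refine forall_congr' fun χ => forall_congr' fun hχ => forall_congr' fun hs => ?_
    have e : ∀ (f : L2R) {g : ℝ → ℂ} (hg : MemLp g 2), pairL2 f (hg.toLp g) = ∫ t, f t * g t := by
      intro f g hg
      rw [pairL2_apply]
      refine integral_congr_ae ?_
      filter_upwards [hg.coeFn_toLp] with t ht
      rw [ht]
    rw [mem_ofPred_eq, e, e]
  rw [key]
  refine isClosed_iInter fun χ => isClosed_iInter fun hχ => isClosed_iInter fun hs => ?_
  refine isClosed_eq ?_ ?_
  · exact (pairL2.flip _).continuous.comp (WithLp.sndL 2 ℂ L2R L2R).continuous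
  · exact ((pairL2.flip _).continuous.comp (WithLp.fstL 2 ℂ L2R L2R).continuous).neg

instance : CompleteSpace H1R := isClosed_h1Submodule.completeSpace_coe

/-! ### Density of Schwartz functions in `H¹` -/

theorem SchwartzMap.isWeakDeriv_toLp (f : 𝓢(ℝ, ℂ)) :
    IsWeakDeriv (f.toLp 2) ((SchwartzMap.derivCLM ℂ ℂ f).toLp 2) :=
  isWeakDeriv_of_contDiff (f.smooth 1) (f.memLp 2 volume)
    ((SchwartzMap.derivCLM ℂ ℂ f).memLp 2 volume)

/-- A Schwartz function as an element of `H¹(ℝ)`. -/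
def H1R.ofSchwartz (f : 𝓢(ℝ, ℂ)) : H1R :=
  H1R.mk (f.toLp 2) ((SchwartzMap.derivCLM ℂ ℂ f).toLp 2) f.isWeakDeriv_toLp

/-- The inclusion of Schwartz functions into `H¹(ℝ)`. -/
def schwartzToH1 : 𝓢(ℝ, ℂ) →ₗ[ℂ] H1R where
  toFun := H1R.ofSchwartz
  map_add' f g := by
    apply H1R.ext_toL2
    rw [map_add]
    exact (SchwartzMap.toLpCLM ℂ ℂ 2 volume).map_add f g
  map_smul' c f := by
    apply H1R.ext_toL2
    rw [map_smul]
    exact (SchwartzMap.toLpCLM ℂ ℂ 2 volume).map_smul c f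

theorem toL2_schwartzToH1 (f : 𝓢(ℝ, ℂ)) : (schwartzToH1 f).toL2 = f.toLp 2 := rfl

theorem weakDeriv_schwartzToH1 (f : 𝓢(ℝ, ℂ)) :
    (schwartzToH1 f).weakDeriv = (SchwartzMap.derivCLM ℂ ℂ f).toLp 2 := rfl

/-- If `u` is `H¹`-orthogonal to all Schwartz functions, choosing `f` with a prescribed transform
`g` shows that `(1 + 4π²ξ²) û` annihilates every test function `g`. The weight is positive, so `û =
0`. -/
theorem denseRange_schwartzToH1 : DenseRange schwartzToH1 := by
  have h : (LinearMap.range schwartzToH1).topologicalClosure = ⊤ := by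
    rw [Submodule.topologicalClosure_eq_top_iff, Submodule.eq_bot_iff]
    intro u hu
    have hae : ∀ᵐ ξ, ((1 + 4 * Real.pi ^ 2 * ξ ^ 2 : ℝ) : ℂ) * (𝓕 u.toL2 : L2R) ξ = 0 := by
      refine ae_eq_zero_of_integral_contDiff_smul_eq_zero
        (L2R.locallyIntegrable_mul (m := fun ξ => ((1 + 4 * Real.pi ^ 2 * ξ ^ 2 : ℝ) : ℂ))
          (by fun_prop) _) fun g hg hgs => ?_
      have hG : ContDiff ℝ ∞ (fun t => (g t : ℂ)) := Complex.ofRealCLM.contDiff.comp hg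
      have hGs : HasCompactSupport (fun t => (g t : ℂ)) :=
        hgs.comp_left (g := Complex.ofReal) (by simp)
      set G : 𝓢(ℝ, ℂ) := hGs.toSchwartzMap hG with hGdef
      have hGa : ∀ t, G t = (g t : ℂ) := fun t => rfl
      set f : 𝓢(ℝ, ℂ) := 𝓕⁻ G
      have hfG : 𝓕 f = G := FourierTransform.fourier_fourierInv_eq G
      have ho := (Submodule.mem_orthogonal _ _).1 hu (schwartzToH1 f) ⟨f, rfl⟩
      rw [H1R.inner_eq, toL2_schwartzToH1, weakDeriv_schwartzToH1, ← Lp.inner_fourier_eq,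
        ← Lp.inner_fourier_eq (SchwartzMap.toLp _ _ _), SchwartzMap.toLp_fourier_eq,
        SchwartzMap.toLp_fourier_eq, inner_toLp_left, inner_toLp_left, hfG, ← integral_add] at ho
      · rw [← ho]
        refine integral_congr_ae ?_
        filter_upwards [u.fourier_weakDeriv] with ξ hξ
        rw [hξ, fourier_derivCLM_apply, hfG, hGa]
        simp only [derivSymbol, Complex.real_smul, map_mul, Complex.conj_ofReal, Complex.conj_I,
          Complex.conj_ofNat]
        push_cast
        linear_combination (4 * (Real.pi : ℂ) ^ 2 * ξ ^ 2 * g ξ * (𝓕 u.toL2 : L2R) ξ) *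
          Complex.I_sq
      · have := L2R.integrable_mul (𝓕 u.toL2) (G.memLp 2 volume).star
        simpa [mul_comm] using this
      · have := L2R.integrable_mul (𝓕 u.weakDeriv)
          ((𝓕 (SchwartzMap.derivCLM ℂ ℂ f)).memLp 2 volume).star
        simpa [mul_comm] using this
    have hz : (𝓕 u.toL2 : L2R) = 0 := by
      refine Lp.ext ?_
      filter_upwards [hae, Lp.coeFn_zero ℂ 2 (volume : Measure ℝ)] with ξ h1 h2
      rw [h2]
      refine (mul_eq_zero.1 h1).resolve_left ?_
      have : (0 : ℝ) < 1 + 4 * Real.pi ^ 2 * ξ ^ 2 := by positivity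
      exact_mod_cast this.ne'
    have : u.toL2 = 0 := by
      apply (Lp.fourierTransformₗᵢ ℝ ℂ).injective
      rw [map_zero]; exact hz
    exact H1R.ext_toL2 (by rw [this, map_zero])
  intro x
  have hx : x ∈ (LinearMap.range schwartzToH1).topologicalClosure := by rw [h]; trivial
  exact hx

/-! ### The Gagliardo–Nirenberg inequality -/

theorem integral_norm_mul_norm_le (f g : L2R) : ∫ t, ‖f t‖ * ‖g t‖ ≤ ‖f‖ * ‖g‖ := by
  have h := real_inner_le_norm ((Lp.memLp f).norm.toLp _) ((Lp.memLp g).norm.toLp _)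
  rw [L2.inner_def] at h
  have e : ∀ f : L2R, ‖(Lp.memLp f).norm.toLp _‖ = ‖f‖ := fun f => by
    rw [Lp.norm_toLp, eLpNorm_norm, Lp.norm_def]
  rw [e, e] at h
  refine le_trans (le_of_eq ?_) h
  refine integral_congr_ae ?_
  filter_upwards [(Lp.memLp f).norm.coeFn_toLp, (Lp.memLp g).norm.coeFn_toLp] with t h1 h2
  rw [h1, h2]
  simp [mul_comm]

/-- The one-dimensional Gagliardo-Nirenberg inequality for Schwartz functions. -/
theorem SchwartzMap.norm_sq_le (f : 𝓢(ℝ, ℂ)) (t : ℝ) :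
    ‖f t‖ ^ 2 ≤ 2 * (‖f.toLp 2 (volume : Measure ℝ)‖ *
      ‖(SchwartzMap.derivCLM ℂ ℂ f).toLp 2 (volume : Measure ℝ)‖) := by
  set f' := SchwartzMap.derivCLM ℂ ℂ f
  have hf' : ∀ s, HasDerivAt f (f' s) s := fun s => f.hasDerivAt s
  have i1 : Integrable (fun s => f s * conj (f' s)) :=
    MemLp.integrable_mul (p := 2) (q := 2) (f.memLp 2 volume) (f'.memLp 2 volume).star
  have i2 : Integrable (fun s => f' s * conj (f s)) :=
    MemLp.integrable_mul (p := 2) (q := 2) (f'.memLp 2 volume) (f.memLp 2 volume).star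
  -- Since `f` vanishes at `-∞`, `|f(t)|²` is the integral of the derivative of `|f|²` over `(-∞,
  -- t]`; the constant 2 counts the two terms of that derivative.
  have hd : ∀ s, HasDerivAt (fun s => f s * conj (f s)) (f' s * conj (f s) + f s * conj (f' s)) s :=
    fun s => (hf' s).mul (hf' s).star
  have hz : Tendsto f atBot (𝓝 0) :=
    (f.toZeroAtInfty.zero_at_infty').mono_left atBot_le_cocompact
  have hlim : Tendsto (fun s => f s * conj (f s)) atBot (𝓝 0) := by
    simpa using hz.mul ((Complex.continuous_conj.tendsto 0).comp hz)
  have hI := integral_Iic_of_hasDerivAt_of_tendsto (a := t) (hd t).continuousAt.continuousWithinAt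
    (fun s _ => hd s) (i2.add i1).integrableOn hlim
  have e : ‖f t‖ ^ 2 = ‖f t * conj (f t)‖ := by rw [norm_mul, RCLike.norm_conj, sq]
  rw [e, ← sub_zero (f t * conj (f t)), ← hI]
  have hb : ∀ s, ‖f' s * conj (f s) + f s * conj (f' s)‖ ≤ 2 * (‖f s‖ * ‖f' s‖) := fun s => by
    refine (norm_add_le _ _).trans (le_of_eq ?_)
    simp only [norm_mul, RCLike.norm_conj]; ring
  have i3 : Integrable (fun s => ‖f s‖ * ‖f' s‖) := by simpa using i1.norm
  calc ‖∫ s in Iic t, f' s * conj (f s) + f s * conj (f' s)‖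
      ≤ ∫ s in Iic t, ‖f' s * conj (f s) + f s * conj (f' s)‖ := norm_integral_le_integral_norm _
    _ ≤ ∫ s in Iic t, 2 * (‖f s‖ * ‖f' s‖) :=
        integral_mono (i2.add i1).norm.integrableOn (i3.const_mul 2).integrableOn hb
    _ ≤ ∫ s, 2 * (‖f s‖ * ‖f' s‖) :=
        setIntegral_le_integral (i3.const_mul 2) (Eventually.of_forall fun s => by positivity)
    _ = 2 * ∫ s, ‖f.toLp 2 volume s‖ * ‖f'.toLp 2 volume s‖ := by
        rw [integral_const_mul]
        congr 1
        refine integral_congr_ae ?_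
        filter_upwards [f.coeFn_toLp 2 volume, f'.coeFn_toLp 2 volume] with s h1 h2
        rw [h1, h2]
    _ ≤ _ := by gcongr; exact integral_norm_mul_norm_le _ _

namespace H1R

/-- The one-dimensional Gagliardo-Nirenberg inequality. -/
theorem ae_norm_sq_le (u : H1R) : ∀ᵐ t, ‖u.toL2 t‖ ^ 2 ≤ 2 * (‖u.toL2‖ * ‖u.weakDeriv‖) := by
  obtain ⟨x, hx, hlim⟩ := mem_closure_iff_seq_limit.1 (denseRange_schwartzToH1 u)
  choose f hf using hx
  have h1 : Tendsto (fun n => (x n).toL2) atTop (𝓝 u.toL2) := (toL2.continuous.tendsto u).comp hlim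
  have h2 : Tendsto (fun n => (x n).weakDeriv) atTop (𝓝 u.weakDeriv) :=
    (weakDeriv.continuous.tendsto u).comp hlim
  -- `L²` convergence gives pointwise convergence only along a subsequence, which suffices because
  -- the right-hand side is continuous on `H¹`.
  obtain ⟨ns, hns, hae⟩ := (tendstoInMeasure_of_tendsto_Lp h1).exists_seq_tendsto_ae
  have h3 : Tendsto (fun n => 2 * (‖(x (ns n)).toL2‖ * ‖(x (ns n)).weakDeriv‖)) atTop
      (𝓝 (2 * (‖u.toL2‖ * ‖u.weakDeriv‖))) :=
    ((h1.norm.mul h2.norm).const_mul 2).comp hns.tendsto_atTop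
  have h4 : ∀ᵐ t, ∀ n, ‖(x (ns n)).toL2 t‖ ^ 2 ≤
      2 * (‖(x (ns n)).toL2‖ * ‖(x (ns n)).weakDeriv‖) := by
    rw [ae_all_iff]
    intro n
    rw [← hf, toL2_schwartzToH1, weakDeriv_schwartzToH1]
    filter_upwards [(f (ns n)).coeFn_toLp 2 volume] with t ht
    rw [ht]
    exact (f (ns n)).norm_sq_le t
  filter_upwards [hae, h4] with t h5 h6
  exact le_of_tendsto_of_tendsto' (h5.norm.pow 2) h3 h6

theorem ae_norm_le (u : H1R) : ∀ᵐ t, ‖u.toL2 t‖ ≤ ‖u‖ := by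
  filter_upwards [u.ae_norm_sq_le] with t ht
  refine abs_le_of_sq_le_sq' ?_ (norm_nonneg _) |>.2
  rw [u.norm_sq_eq]
  nlinarith [sq_nonneg (‖u.toL2‖ - ‖u.weakDeriv‖)]

theorem memLp_mul (u : H1R) (g : L2R) : MemLp (fun t => u.toL2 t * g t) 2 := by
  have : MemLp u.toL2 ⊤ :=
    memLp_top_of_bound (Lp.aestronglyMeasurable _) ‖u‖ u.ae_norm_le
  exact MemLp.mul (p := ⊤) (q := 2) (r := 2) (Lp.memLp g) this

/-! ### `H¹` as an algebra, and the cubic nonlinearity -/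

/-- Multiplication of an `L²` function by an `H¹` function. -/
def mulL2 : H1R →L[ℂ] L2R →L[ℂ] L2R :=
  LinearMap.mkContinuous₂
    (LinearMap.mk₂ ℂ (fun u g => (memLp_mul u g).toLp _)
      (fun u v g => by
        refine Lp.ext ?_
        filter_upwards [(memLp_mul (u + v) g).coeFn_toLp, (memLp_mul u g).coeFn_toLp,
          (memLp_mul v g).coeFn_toLp,
          Lp.coeFn_add ((memLp_mul u g).toLp _) ((memLp_mul v g).toLp _),
          Lp.coeFn_add u.toL2 v.toL2] with t h1 h2 h3 h4 h5
        rw [h1, h4, Pi.add_apply, h2, h3, map_add, h5, Pi.add_apply, add_mul])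
      (fun c u g => by
        refine Lp.ext ?_
        filter_upwards [(memLp_mul (c • u) g).coeFn_toLp, (memLp_mul u g).coeFn_toLp,
          Lp.coeFn_smul c ((memLp_mul u g).toLp _),
          Lp.coeFn_smul c u.toL2] with t h1 h2 h3 h4
        rw [h1, h3, Pi.smul_apply, h2, map_smul, h4, Pi.smul_apply, smul_mul_assoc])
      (fun u g k => by
        refine Lp.ext ?_
        filter_upwards [(memLp_mul u (g + k)).coeFn_toLp, (memLp_mul u g).coeFn_toLp,
          (memLp_mul u k).coeFn_toLp,
          Lp.coeFn_add ((memLp_mul u g).toLp _) ((memLp_mul u k).toLp _),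
          Lp.coeFn_add g k] with t h1 h2 h3 h4 h5
        rw [h1, h4, Pi.add_apply, h2, h3, h5, Pi.add_apply, mul_add])
      (fun c u g => by
        refine Lp.ext ?_
        filter_upwards [(memLp_mul u (c • g)).coeFn_toLp, (memLp_mul u g).coeFn_toLp,
          Lp.coeFn_smul c ((memLp_mul u g).toLp _), Lp.coeFn_smul c g] with t h1 h2 h3 h4
        rw [h1, h3, Pi.smul_apply, h2, h4, Pi.smul_apply, mul_smul_comm]))
    1 (fun u g => by
      rw [one_mul]
      refine Lp.norm_le_mul_norm_of_ae_le_mul ?_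
      rw [LinearMap.mk₂_apply]
      filter_upwards [(memLp_mul u g).coeFn_toLp, u.ae_norm_le] with t h1 h2
      rw [h1, norm_mul]
      gcongr)

theorem coeFn_mulL2 (u : H1R) (g : L2R) : ∀ᵐ t, mulL2 u g t = u.toL2 t * g t :=
  (memLp_mul u g).coeFn_toLp

theorem norm_mulL2_le (u : H1R) (g : L2R) : ‖mulL2 u g‖ ≤ ‖u‖ * ‖g‖ := by
  refine Lp.norm_le_mul_norm_of_ae_le_mul ?_
  filter_upwards [coeFn_mulL2 u g, u.ae_norm_le] with t h1 h2
  rw [h1, norm_mul]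
  gcongr

/-- The Leibniz rule in `H¹(ℝ)`. -/
theorem isWeakDeriv_mul (u v : H1R) :
    IsWeakDeriv (mulL2 u v.toL2) (mulL2 u v.weakDeriv + mulL2 v u.weakDeriv : L2R) := by
  intro χ hχ hs
  have h0 : MemLp χ 2 := hχ.continuous.memLp_of_hasCompactSupport hs
  have h1 : MemLp (deriv χ) 2 :=
    (hχ.continuous_deriv le_rfl).memLp_of_hasCompactSupport hs.deriv
  have e : ∀ (f : L2R) {g : ℝ → ℂ} (hg : MemLp g 2), ∫ t, f t * g t = pairL2 f (hg.toLp g) := by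
    intro f g hg
    rw [pairL2_apply]
    refine integral_congr_ae ?_
    filter_upwards [hg.coeFn_toLp] with t ht
    rw [ht]
  rw [e _ h0, e _ h1]
  -- For fixed `v` both sides are continuous in `u`, so `u` may be a Schwartz function `f`; then `f
  -- χ` is an admissible test function for the weak derivative of `v`.
  refine denseRange_schwartzToH1.induction_on (p := fun u : H1R =>
    pairL2 (mulL2 u v.weakDeriv + mulL2 v u.weakDeriv) (h0.toLp χ) =
      -pairL2 (mulL2 u v.toL2) (h1.toLp (deriv χ))) u ?_ ?_
  · refine isClosed_eq ?_ ?_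
    · exact (pairL2.flip _).continuous.comp
        (((mulL2.flip _).continuous).add ((mulL2 v).continuous.comp weakDeriv.continuous))
    · exact ((pairL2.flip _).continuous.comp (mulL2.flip _).continuous).neg
  · intro f
    set f' := SchwartzMap.derivCLM ℂ ℂ f
    have hf1 : ContDiff ℝ 1 f := f.smooth 1
    have hd : deriv (fun t => f t * χ t) = fun t => f' t * χ t + f t * deriv χ t := by
      ext t
      exact ((f.hasDerivAt t).mul (hχ.differentiable one_ne_zero t).hasDerivAt).deriv
    have hv := v.isWeakDeriv _ (hf1.mul hχ) (hs.mul_left)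
    rw [hd] at hv
    have m1 : Continuous (fun t => f' t * χ t) := f'.continuous.mul hχ.continuous
    have m2 : Continuous (fun t => f t * deriv χ t) :=
      f.continuous.mul (hχ.continuous_deriv le_rfl)
    have i1 := L2R.integrable_mul_test v.toL2 m1 hs.mul_left
    have i2 := L2R.integrable_mul_test v.toL2 m2 hs.deriv.mul_left
    simp only [mul_add] at hv
    rw [integral_add i1 i2] at hv
    rw [map_add, add_apply, ← e _ h0, ← e _ h0, ← e _ h1]
    have e1 : ∫ t, mulL2 (schwartzToH1 f) v.weakDeriv t * χ t =
        ∫ t, v.weakDeriv t * (f t * χ t) := by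
      refine integral_congr_ae ?_
      filter_upwards [coeFn_mulL2 (schwartzToH1 f) v.weakDeriv, f.coeFn_toLp 2 volume] with t h2 h3
      rw [h2, toL2_schwartzToH1, h3]; ring
    have e2 : ∫ t, mulL2 v (schwartzToH1 f).weakDeriv t * χ t =
        ∫ t, v.toL2 t * (f' t * χ t) := by
      refine integral_congr_ae ?_
      filter_upwards [coeFn_mulL2 v (schwartzToH1 f).weakDeriv, f'.coeFn_toLp 2 volume] with t h2 h3
      rw [h2, weakDeriv_schwartzToH1, h3]; ring
    have e3 : ∫ t, mulL2 (schwartzToH1 f) v.toL2 t * deriv χ t =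
        ∫ t, v.toL2 t * (f t * deriv χ t) := by
      refine integral_congr_ae ?_
      filter_upwards [coeFn_mulL2 (schwartzToH1 f) v.toL2, f.coeFn_toLp 2 volume] with t h2 h3
      rw [h2, toL2_schwartzToH1, h3]; ring
    rw [e1, e2, e3, hv]
    ring

/-- The norm of `H¹` is controlled by the sum of the `L²` norms. -/
theorem norm_le_add (u : H1R) : ‖u‖ ≤ ‖u.toL2‖ + ‖u.weakDeriv‖ := by
  refine abs_le_of_sq_le_sq' ?_ (by positivity) |>.2
  rw [u.norm_sq_eq]
  nlinarith [mul_nonneg (norm_nonneg u.toL2) (norm_nonneg u.weakDeriv)]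

/-- The product of two functions in `H¹(ℝ)`. -/
def mulFun (u v : H1R) : H1R := H1R.mk _ _ (isWeakDeriv_mul u v)

/-- The product on `H¹(ℝ)` as a continuous bilinear map. -/
def mul : H1R →L[ℂ] H1R →L[ℂ] H1R :=
  LinearMap.mkContinuous₂
    (LinearMap.mk₂ ℂ mulFun
      (fun u v w => ext_toL2 (by simp [mulFun]))
      (fun c u w => ext_toL2 (by simp [mulFun]))
      (fun u v w => ext_toL2 (by simp [mulFun]))
      (fun c u w => ext_toL2 (by simp [mulFun])))
    -- The three products `u v`, `u v'` and `v u'` each have `L²` norm at most `‖u‖ ‖v‖`.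
    3 (fun u v => by
      rw [LinearMap.mk₂_apply]
      refine (norm_le_add _).trans ?_
      rw [mulFun, toL2_mk, weakDeriv_mk]
      have h1 := norm_mulL2_le u v.toL2
      have h2 := norm_mulL2_le u v.weakDeriv
      have h3 := norm_mulL2_le v u.weakDeriv
      have h4 := norm_add_le (mulL2 u v.weakDeriv) (mulL2 v u.weakDeriv)
      have h5 := mul_le_mul_of_nonneg_left v.norm_toL2_le (norm_nonneg u)
      have h6 := mul_le_mul_of_nonneg_left v.norm_weakDeriv_le (norm_nonneg u)
      have h7 := mul_le_mul_of_nonneg_left u.norm_weakDeriv_le (norm_nonneg v)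
      linarith)

theorem coeFn_mul (u v : H1R) : ∀ᵐ t, (mul u v).toL2 t = u.toL2 t * v.toL2 t :=
  coeFn_mulL2 u v.toL2

theorem norm_mul_le (u v : H1R) : ‖mul u v‖ ≤ 3 * ‖u‖ * ‖v‖ :=
  ContinuousLinearMap.le_of_opNorm₂_le_of_le _ (LinearMap.mkContinuous₂_norm_le _ (by norm_num) _)
    le_rfl le_rfl

theorem isWeakDeriv_conj (u : H1R) : IsWeakDeriv (conjL2 u.toL2) (conjL2 u.weakDeriv) := by
  intro χ hχ hs
  have hc : ContDiff ℝ 1 (fun t => conj (χ t)) := Complex.conjCLE.contDiff.comp hχ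
  have hcd : deriv (fun t => conj (χ t)) = fun t => conj (deriv χ t) := by
    ext t
    exact ((hχ.differentiable one_ne_zero t).hasDerivAt.star).deriv
  have h := u.isWeakDeriv _ hc (hs.comp_left (g := conj) (by simp))
  rw [hcd] at h
  have e : ∀ (f : L2R) (g : ℝ → ℂ), ∫ t, conjL2 f t * g t = conj (∫ t, f t * conj (g t)) := by
    intro f g
    rw [← integral_conj]
    refine integral_congr_ae ?_
    filter_upwards [coeFn_conjL2 f] with t ht
    simp [ht]
  rw [e, e, h, map_neg]

/-- Complex conjugation on `H¹(ℝ)`. -/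
def conjFun (u : H1R) : H1R := H1R.mk _ _ u.isWeakDeriv_conj

theorem norm_conjFun (u : H1R) : ‖conjFun u‖ = ‖u‖ := by
  have : ‖conjFun u‖ ^ 2 = ‖u‖ ^ 2 := by
    rw [norm_sq_eq, norm_sq_eq, conjFun, toL2_mk, weakDeriv_mk, norm_conjL2, norm_conjL2]
  exact (sq_eq_sq₀ (norm_nonneg _) (norm_nonneg _)).1 this

/-- Complex conjugation on `H¹(ℝ)`, as a conjugate-linear map. -/
def conjH1 : H1R →L⋆[ℂ] H1R :=
  LinearMap.mkContinuous
    { toFun := conjFun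
      map_add' := fun u v => ext_toL2 (by simp [conjFun])
      map_smul' := fun c u => ext_toL2 (by simp [conjFun]) }
    1 (fun u => by rw [one_mul]; exact (norm_conjFun u).le)

@[simp] theorem toL2_conjH1 (u : H1R) : (conjH1 u).toL2 = conjL2 u.toL2 := rfl

@[simp] theorem weakDeriv_conjH1 (u : H1R) : (conjH1 u).weakDeriv = conjL2 u.weakDeriv := rfl

@[simp] theorem norm_conjH1 (u : H1R) : ‖conjH1 u‖ = ‖u‖ := norm_conjFun u

/-- The function `|u|²`. -/
def absSq (u : H1R) : H1R := mul u (conjH1 u)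

theorem coeFn_absSq (u : H1R) : ∀ᵐ t, (absSq u).toL2 t = (‖u.toL2 t‖ ^ 2 : ℝ) := by
  filter_upwards [coeFn_mul u (conjH1 u), coeFn_conjL2 u.toL2] with t h1 h2
  rw [absSq, h1, toL2_conjH1, h2, Complex.mul_conj, Complex.normSq_eq_norm_sq]

theorem continuous_absSq : Continuous absSq := by
  unfold absSq
  exact (mul.continuous.clm_apply conjH1.continuous)

/-- The cubic nonlinearity `|u|² u`. -/
def cubic (u : H1R) : H1R := mul (absSq u) u

theorem coeFn_cubic (u : H1R) :
    ∀ᵐ t, (cubic u).toL2 t = (‖u.toL2 t‖ ^ 2 : ℝ) * u.toL2 t := by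
  filter_upwards [coeFn_mul (absSq u) u, coeFn_absSq u] with t h1 h2
  rw [cubic, h1, h2]

theorem continuous_cubic : Continuous cubic := by
  unfold cubic
  exact ((mul.continuous.comp continuous_absSq).clm_apply continuous_id)

theorem norm_absSq_le (u : H1R) : ‖absSq u‖ ≤ 3 * ‖u‖ ^ 2 := by
  have := norm_mul_le u (conjH1 u)
  rw [norm_conjH1] at this
  rw [absSq]; linarith

theorem norm_cubic_le {u : H1R} {R : ℝ} (hu : ‖u‖ ≤ R) : ‖cubic u‖ ≤ 9 * R ^ 3 := by
  have h1 := norm_mul_le (absSq u) u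
  have h2 := norm_absSq_le u
  calc ‖cubic u‖ ≤ 3 * ‖absSq u‖ * ‖u‖ := h1
    _ ≤ 3 * (3 * ‖u‖ ^ 2) * ‖u‖ := by gcongr
    _ = 9 * ‖u‖ ^ 3 := by ring
    _ ≤ 9 * R ^ 3 := by gcongr

theorem norm_cubic_sub_le {u v : H1R} {R : ℝ} (hu : ‖u‖ ≤ R) (hv : ‖v‖ ≤ R) :
    ‖cubic u - cubic v‖ ≤ 27 * R ^ 2 * ‖u - v‖ := by
  have hR : 0 ≤ R := (norm_nonneg u).trans hu
  have e1 : absSq u - absSq v = mul u (conjH1 (u - v)) + mul (u - v) (conjH1 v) := by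
    simp [absSq, map_sub]
  have e2 : cubic u - cubic v = mul (absSq u) (u - v) + mul (absSq u - absSq v) v := by
    simp [cubic, map_sub]
  have h1 : ‖absSq u - absSq v‖ ≤ 6 * R * ‖u - v‖ := by
    rw [e1]
    calc _ ≤ 3 * ‖u‖ * ‖conjH1 (u - v)‖ + 3 * ‖u - v‖ * ‖conjH1 v‖ :=
          (norm_add_le _ _).trans (add_le_add (norm_mul_le _ _) (norm_mul_le _ _))
      _ ≤ 3 * R * ‖u - v‖ + 3 * ‖u - v‖ * R := by
          rw [norm_conjH1, norm_conjH1]; gcongr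
      _ = _ := by ring
  have h2 : ‖absSq u‖ ≤ 3 * R ^ 2 := (norm_absSq_le u).trans (by gcongr)
  rw [e2]
  calc _ ≤ 3 * ‖absSq u‖ * ‖u - v‖ + 3 * ‖absSq u - absSq v‖ * ‖v‖ :=
        (norm_add_le _ _).trans (add_le_add (norm_mul_le _ _) (norm_mul_le _ _))
    _ ≤ 3 * (3 * R ^ 2) * ‖u - v‖ + 3 * (6 * R * ‖u - v‖) * R := by gcongr
    _ = _ := by ring

/-- The `H¹` bounds enter only as pointwise bounds, so the difference is measured in `L²` on both
sides. This is the estimate that closes Grönwall in the uniqueness proof. -/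
theorem norm_toL2_cubic_sub_le {u v : H1R} {R : ℝ} (hu : ‖u‖ ≤ R) (hv : ‖v‖ ≤ R) :
    ‖(cubic u).toL2 - (cubic v).toL2‖ ≤ 3 * R ^ 2 * ‖u.toL2 - v.toL2‖ := by
  have hR : 0 ≤ R := (norm_nonneg u).trans hu
  refine Lp.norm_le_mul_norm_of_ae_le_mul ?_
  filter_upwards [Lp.coeFn_sub (cubic u).toL2 (cubic v).toL2, Lp.coeFn_sub u.toL2 v.toL2,
    coeFn_cubic u, coeFn_cubic v, u.ae_norm_le, v.ae_norm_le] with t h1 h2 h3 h4 h5 h6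
  rw [h1, h2, Pi.sub_apply, Pi.sub_apply, h3, h4]
  set a := u.toL2 t
  set b := v.toL2 t
  have ha : ‖a‖ ≤ R := h5.trans hu
  have hb : ‖b‖ ≤ R := h6.trans hv
  have e : ((‖a‖ ^ 2 : ℝ) : ℂ) * a - ((‖b‖ ^ 2 : ℝ) : ℂ) * b =
      ((‖a‖ ^ 2 : ℝ) : ℂ) * (a - b) + (((‖a‖ - ‖b‖) * (‖a‖ + ‖b‖) : ℝ) : ℂ) * b := by
    push_cast; ring
  rw [e]
  calc _ ≤ ‖a‖ ^ 2 * ‖a - b‖ + |‖a‖ - ‖b‖| * (‖a‖ + ‖b‖) * ‖b‖ := by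
        refine (norm_add_le _ _).trans (le_of_eq ?_)
        simp only [norm_mul, Complex.norm_real, Real.norm_eq_abs, abs_pow, abs_norm]
        rw [abs_of_nonneg (by positivity : 0 ≤ ‖a‖ + ‖b‖)]
    _ ≤ R ^ 2 * ‖a - b‖ + ‖a - b‖ * (R + R) * R := by
        gcongr; exact abs_norm_sub_norm_le a b
    _ = _ := by ring

end H1R

/-! ### The free Schrödinger group -/

/-- The Fourier symbol `e^{-4π²iξ²z}` of the free Schrödinger group. -/
def schrSymbol (z ξ : ℝ) : ℂ := Complex.exp ((-(4 * Real.pi ^ 2 * ξ ^ 2 * z) : ℝ) * Complex.I)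

@[simp] theorem norm_schrSymbol (z ξ : ℝ) : ‖schrSymbol z ξ‖ = 1 := Complex.norm_exp_ofReal_mul_I _

theorem continuous_schrSymbol (z : ℝ) : Continuous (schrSymbol z) := by
  unfold schrSymbol; fun_prop

theorem hasDerivAt_schrSymbol (z ξ : ℝ) :
    HasDerivAt (fun z => schrSymbol z ξ)
      (-(4 * Real.pi ^ 2 * ξ ^ 2) * Complex.I * schrSymbol z ξ) z := by
  have h : HasDerivAt (fun z : ℝ => ((-(4 * Real.pi ^ 2 * ξ ^ 2 * z) : ℝ) : ℂ) * Complex.I)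
      (((-(4 * Real.pi ^ 2 * ξ ^ 2 * 1) : ℝ) : ℂ) * Complex.I) z :=
    ((((hasDerivAt_id z).const_mul (4 * Real.pi ^ 2 * ξ ^ 2)).neg).ofReal_comp).mul_const _
  have e : -(4 * Real.pi ^ 2 * ξ ^ 2) * Complex.I * schrSymbol z ξ = schrSymbol z ξ *
      (((-(4 * Real.pi ^ 2 * ξ ^ 2 * 1) : ℝ) : ℂ) * Complex.I) := by
    push_cast
    ring
  rw [e]
  exact h.cexp

theorem schrSymbol_add (a b ξ : ℝ) : schrSymbol (a + b) ξ = schrSymbol a ξ * schrSymbol b ξ := by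
  rw [schrSymbol, schrSymbol, schrSymbol, ← Complex.exp_add]
  congr 1
  push_cast
  ring

theorem memLp_schrSymbol_mul (z : ℝ) (g : L2R) : MemLp (fun ξ => schrSymbol z ξ * g ξ) 2 :=
  (Lp.memLp g).of_le
    ((continuous_schrSymbol z).aestronglyMeasurable.mul (Lp.aestronglyMeasurable g))
    (Eventually.of_forall fun ξ => by simp)

/-- Multiplication by the symbol of the Schrödinger group. -/
def schrMul (z : ℝ) : L2R →ₗᵢ[ℂ] L2R where
  toFun g := (memLp_schrSymbol_mul z g).toLp _
  map_add' g k := by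
    refine Lp.ext ?_
    filter_upwards [(memLp_schrSymbol_mul z (g + k)).coeFn_toLp,
      (memLp_schrSymbol_mul z g).coeFn_toLp, (memLp_schrSymbol_mul z k).coeFn_toLp,
      Lp.coeFn_add ((memLp_schrSymbol_mul z g).toLp _) ((memLp_schrSymbol_mul z k).toLp _),
      Lp.coeFn_add g k] with t h1 h2 h3 h4 h5
    rw [h1, h4, Pi.add_apply, h2, h3, h5, Pi.add_apply, mul_add]
  map_smul' c g := by
    refine Lp.ext ?_
    filter_upwards [(memLp_schrSymbol_mul z (c • g)).coeFn_toLp,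
      (memLp_schrSymbol_mul z g).coeFn_toLp,
      Lp.coeFn_smul c ((memLp_schrSymbol_mul z g).toLp _), Lp.coeFn_smul c g] with t h1 h2 h3 h4
    rw [RingHom.id_apply, h1, h3, Pi.smul_apply, h2, h4, Pi.smul_apply, mul_smul_comm]
  norm_map' g := by
    apply le_antisymm <;> apply Lp.norm_le_norm_of_ae_le <;>
      filter_upwards [(memLp_schrSymbol_mul z g).coeFn_toLp] with t ht <;> simp [ht]

theorem coeFn_schrMul (z : ℝ) (g : L2R) : ∀ᵐ ξ, schrMul z g ξ = schrSymbol z ξ * g ξ :=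
  (memLp_schrSymbol_mul z g).coeFn_toLp

theorem continuous_inner_schrMul (h g : L2R) : Continuous fun z => inner ℂ h (schrMul z g) := by
  have e : ∀ z, inner ℂ h (schrMul z g) = ∫ ξ, conj (h ξ) * (schrSymbol z ξ * g ξ) := fun z => by
    rw [inner_eq_integral]
    refine integral_congr_ae ?_
    filter_upwards [coeFn_schrMul z g] with ξ hξ
    rw [hξ]
  simp only [e]
  have hi : Integrable (fun ξ => conj (h ξ) * g ξ) := by
    simpa [mul_comm] using L2R.integrable_mul g (Lp.memLp h).star
  refine continuous_of_dominated (bound := fun ξ => ‖conj (h ξ) * g ξ‖) (fun z => ?_)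
    (fun z => Eventually.of_forall fun ξ => by simp) hi.norm (Eventually.of_forall fun ξ => ?_)
  · exact (Lp.memLp h).star.aestronglyMeasurable.mul
      (memLp_schrSymbol_mul z g).aestronglyMeasurable
  · unfold schrSymbol; fun_prop

/-- For isometries weak continuity implies strong continuity: `‖a - b‖² = 2‖g‖² - 2 Re⟨b, a⟩` when
`‖a‖ = ‖b‖ = ‖g‖`. -/
theorem continuous_schrMul (g : L2R) : Continuous fun z => schrMul z g := by
  rw [continuous_iff_continuousAt]
  intro z₀
  rw [ContinuousAt, tendsto_iff_norm_sub_tendsto_zero]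
  have h1 : Tendsto (fun z => 2 * ‖g‖ ^ 2 - 2 * (inner ℂ (schrMul z₀ g) (schrMul z g)).re) (𝓝 z₀)
      (𝓝 0) := by
    have h := (Complex.continuous_re.comp (continuous_inner_schrMul (schrMul z₀ g) g)).tendsto z₀
    have e : (inner ℂ (schrMul z₀ g) (schrMul z₀ g)).re = ‖g‖ ^ 2 := by
      rw [LinearIsometry.inner_map_map]
      exact inner_self_eq_norm_sq (𝕜 := ℂ) g
    have h2 := (h.const_mul 2).const_sub (2 * ‖g‖ ^ 2)
    rw [Function.comp_apply, e, sub_self] at h2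
    exact h2
  have h2 : (fun z => ‖schrMul z g - schrMul z₀ g‖ ^ 2) =
      fun z => 2 * ‖g‖ ^ 2 - 2 * (inner ℂ (schrMul z₀ g) (schrMul z g)).re := by
    ext z
    rw [norm_sub_rev, @norm_sub_sq ℂ, LinearIsometry.norm_map, LinearIsometry.norm_map]
    simp only [RCLike.re_eq_complex_re]
    ring
  rw [← h2] at h1
  have h3 := h1.sqrt
  simpa using h3

/-- The free Schrödinger group on `L²(ℝ)`. -/
def schrL2 (z : ℝ) : L2R →ₗᵢ[ℂ] L2R :=
  (Lp.fourierTransformₗᵢ ℝ ℂ).symm.toLinearIsometry.comp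
    ((schrMul z).comp (Lp.fourierTransformₗᵢ ℝ ℂ).toLinearIsometry)

theorem fourier_schrL2 (z : ℝ) (u : L2R) : (𝓕 (schrL2 z u) : L2R) = schrMul z (𝓕 u) :=
  (Lp.fourierTransformₗᵢ ℝ ℂ).apply_symm_apply _

theorem continuous_schrL2 (u : L2R) : Continuous fun z => schrL2 z u :=
  (Lp.fourierTransformₗᵢ ℝ ℂ).symm.continuous.comp (continuous_schrMul (𝓕 u))

theorem schrL2_add (a b : ℝ) (u : L2R) : schrL2 (a + b) u = schrL2 a (schrL2 b u) := by
  apply (Lp.fourierTransformₗᵢ ℝ ℂ).injective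
  change (𝓕 (schrL2 (a + b) u) : L2R) = 𝓕 (schrL2 a (schrL2 b u))
  rw [fourier_schrL2, fourier_schrL2, fourier_schrL2]
  refine Lp.ext ?_
  filter_upwards [coeFn_schrMul (a + b) (𝓕 u), coeFn_schrMul b (𝓕 u),
    coeFn_schrMul a (schrMul b (𝓕 u))] with ξ h1 h2 h3
  rw [h1, h3, h2, schrSymbol_add, mul_assoc]

theorem schrL2_zero (u : L2R) : schrL2 0 u = u := by
  apply (Lp.fourierTransformₗᵢ ℝ ℂ).injective
  change (𝓕 (schrL2 0 u) : L2R) = 𝓕 u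
  rw [fourier_schrL2]
  refine Lp.ext ?_
  filter_upwards [coeFn_schrMul 0 (𝓕 u)] with ξ h1
  rw [h1]
  simp [schrSymbol]

namespace H1R

theorem isWeakDeriv_schrL2 (z : ℝ) (u : H1R) :
    IsWeakDeriv (schrL2 z u.toL2) (schrL2 z u.weakDeriv) := by
  refine isWeakDeriv_of_fourier ?_
  rw [fourier_schrL2, fourier_schrL2]
  filter_upwards [u.fourier_weakDeriv, coeFn_schrMul z (𝓕 u.toL2),
    coeFn_schrMul z (𝓕 u.weakDeriv)] with ξ h1 h2 h3
  rw [h2, h3, h1]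
  ring

/-- The action of the free Schrödinger group on an element of `H¹(ℝ)`. -/
def schrFun (z : ℝ) (u : H1R) : H1R := H1R.mk _ _ (isWeakDeriv_schrL2 z u)

/-- The free Schrödinger group on `H¹(ℝ)`. -/
def schr (z : ℝ) : H1R →ₗᵢ[ℂ] H1R where
  toFun := schrFun z
  map_add' u v := ext_toL2 (by simp [schrFun])
  map_smul' c u := ext_toL2 (by simp [schrFun])
  norm_map' u := by
    have : ‖schrFun z u‖ ^ 2 = ‖u‖ ^ 2 := by
      rw [norm_sq_eq, norm_sq_eq, schrFun, toL2_mk, weakDeriv_mk, LinearIsometry.norm_map,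
        LinearIsometry.norm_map]
    exact (sq_eq_sq₀ (norm_nonneg _) (norm_nonneg _)).1 this

@[simp] theorem toL2_schr (z : ℝ) (u : H1R) : (schr z u).toL2 = schrL2 z u.toL2 := rfl

@[simp] theorem weakDeriv_schr (z : ℝ) (u : H1R) : (schr z u).weakDeriv = schrL2 z u.weakDeriv :=
  rfl

theorem schr_add (a b : ℝ) (u : H1R) : schr (a + b) u = schr a (schr b u) :=
  ext_toL2 (by simp [schrL2_add])

@[simp] theorem schr_zero (u : H1R) : schr 0 u = u := ext_toL2 (by simp [schrL2_zero])

@[simp] theorem schr_schr_neg (z : ℝ) (u : H1R) : schr z (schr (-z) u) = u := by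
  rw [← schr_add]; simp

theorem continuous_schr (u : H1R) : Continuous fun z => schr z u := by
  rw [continuous_iff_continuousAt]
  intro z₀
  rw [ContinuousAt, tendsto_iff_norm_sub_tendsto_zero]
  have h1 := ((tendsto_iff_norm_sub_tendsto_zero.1 ((continuous_schrL2 u.toL2).tendsto z₀))).add
    ((tendsto_iff_norm_sub_tendsto_zero.1 ((continuous_schrL2 u.weakDeriv).tendsto z₀)))
  rw [add_zero] at h1
  refine squeeze_zero (fun _ => norm_nonneg _) (fun z => ?_) h1
  refine (norm_le_add _).trans (le_of_eq ?_)
  rw [map_sub, map_sub]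
  simp

/-- The Schrödinger group acts jointly continuously. -/
theorem tendsto_schr {α : Type*} {l : Filter α} {z : α → ℝ} {u : α → H1R} {z₀ : ℝ} {u₀ : H1R}
    (hz : Tendsto z l (𝓝 z₀)) (hu : Tendsto u l (𝓝 u₀)) :
    Tendsto (fun a => schr (z a) (u a)) l (𝓝 (schr z₀ u₀)) := by
  rw [tendsto_iff_norm_sub_tendsto_zero]
  have h1 := (tendsto_iff_norm_sub_tendsto_zero.1 hu).add
    (tendsto_iff_norm_sub_tendsto_zero.1 (((continuous_schr u₀).tendsto z₀).comp hz))
  rw [add_zero] at h1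
  refine squeeze_zero (fun _ => norm_nonneg _) (fun a => ?_) h1
  have e : schr (z a) (u a) - schr z₀ u₀ =
      schr (z a) (u a - u₀) + (schr (z a) u₀ - schr z₀ u₀) := by rw [map_sub]; abel
  rw [e]
  refine (norm_add_le _ _).trans (le_of_eq ?_)
  rw [LinearIsometry.norm_map]
  rfl

end H1R

/-! ### Differentiating the free flow in `H⁻¹` -/

namespace HNeg1R

/-- The inclusion `L²(ℝ) → H⁻¹(ℝ)` as a continuous linear map. -/
def ofL2CLM : L2R →L[ℂ] HNeg1R :=
  ((ContinuousLinearMap.compL ℂ H1R L2R ℂ).flip H1R.toL2).comp pairL2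

/-- The inclusion `H¹(ℝ) → H⁻¹(ℝ)` as a continuous linear map. -/
def ofH1CLM : H1R →L[ℂ] HNeg1R := ofL2CLM.comp H1R.toL2

/-- The second derivative `H¹(ℝ) → H⁻¹(ℝ)` as a continuous linear map. -/
def secondDerivCLM : H1R →L[ℂ] HNeg1R :=
  -(((ContinuousLinearMap.compL ℂ H1R L2R ℂ).flip H1R.weakDeriv).comp
    (pairL2.comp H1R.weakDeriv))

theorem ofH1CLM_apply (u : H1R) : ofH1CLM u = ofH1 u := rfl

theorem ofL2_apply (f : L2R) (w : H1R) : ofL2 f w = pairL2 f w.toL2 := rfl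

theorem ofH1_apply (u w : H1R) : ofH1 u w = pairL2 u.toL2 w.toL2 := rfl

theorem secondDeriv_apply (u w : H1R) :
    u.secondDeriv w = -pairL2 u.weakDeriv w.weakDeriv := rfl

end HNeg1R

namespace H1R

/-- Differentiation under the frequency integral produces a factor `ξ²`. Giving one `ξ` to `u` and
one to `w` yields an integrable majorant independent of `z`, because both lie in `H¹`. -/
theorem hasDerivAt_ofH1_schr_apply (u w : H1R) (z : ℝ) :
    HasDerivAt (fun z => HNeg1R.ofH1 (schr z u) w) (Complex.I * (schr z u).secondDeriv w) z := by
  set p : L2R := 𝓕 (conjH1 w).toL2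
  set q : L2R := 𝓕 u.toL2
  have e1 : ∀ z, HNeg1R.ofH1 (schr z u) w = ∫ ξ, conj (p ξ) * (schrSymbol z ξ * q ξ) := fun z => by
    rw [HNeg1R.ofH1_apply, pairL2_comm, pairL2_eq_inner, ← toL2_conjH1, toL2_schr,
      ← Lp.inner_fourier_eq, fourier_schrL2, inner_eq_integral]
    refine integral_congr_ae ?_
    filter_upwards [coeFn_schrMul z q] with ξ hξ
    rw [hξ]
  have hp := (conjH1 w).fourier_weakDeriv
  have hq := u.fourier_weakDeriv
  have e2 : Complex.I * (schr z u).secondDeriv w =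
      ∫ ξ, conj (p ξ) * (-(4 * Real.pi ^ 2 * ξ ^ 2) * Complex.I * schrSymbol z ξ * q ξ) := by
    rw [HNeg1R.secondDeriv_apply, pairL2_comm, pairL2_eq_inner, ← weakDeriv_conjH1, weakDeriv_schr,
      ← Lp.inner_fourier_eq, fourier_schrL2, inner_eq_integral, ← integral_neg,
      ← integral_const_mul]
    refine integral_congr_ae ?_
    filter_upwards [coeFn_schrMul z (𝓕 u.weakDeriv), hp, hq] with ξ h1 h2 h3
    rw [h1, h2, h3, map_mul, conj_derivSymbol, derivSymbol]
    linear_combination (4 * (Real.pi : ℂ) ^ 2 * ξ ^ 2 * conj (p ξ) * schrSymbol z ξ * q ξ) *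
      Complex.I * Complex.I_sq
  simp only [e1]
  rw [e2]
  have hm : ∀ z, AEStronglyMeasurable (fun ξ => conj (p ξ) * (schrSymbol z ξ * q ξ)) := fun z =>
    (Lp.memLp p).star.aestronglyMeasurable.mul (memLp_schrSymbol_mul z q).aestronglyMeasurable
  have hb : ∀ᵐ ξ, ∀ x : ℝ, ‖conj (p ξ) * (-(4 * Real.pi ^ 2 * ξ ^ 2) * Complex.I *
      schrSymbol x ξ * q ξ)‖ = ‖(𝓕 u.weakDeriv : L2R) ξ * conj
        ((𝓕 (conjH1 w).weakDeriv : L2R) ξ)‖ := by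
    filter_upwards [hp, hq] with ξ h2 h3 x
    rw [h2, h3]
    have : ‖derivSymbol ξ‖ ^ 2 = 4 * Real.pi ^ 2 * ξ ^ 2 := by
      rw [← Complex.normSq_eq_norm_sq, derivSymbol]
      simp [Complex.normSq_ofReal]
      ring
    have h4 : ‖(-(4 * Real.pi ^ 2 * ξ ^ 2) : ℂ)‖ = ‖derivSymbol ξ‖ ^ 2 := by
      rw [this]
      have : (-(4 * Real.pi ^ 2 * ξ ^ 2) : ℂ) = ((-(4 * Real.pi ^ 2 * ξ ^ 2) : ℝ) : ℂ) := by
        push_cast; ring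
      rw [this, Complex.norm_real, norm_neg, Real.norm_of_nonneg (by positivity)]
    simp only [norm_mul, RCLike.norm_conj, h4, norm_schrSymbol, Complex.norm_I]
    ring
  have hi : Integrable (fun ξ => (𝓕 u.weakDeriv : L2R) ξ * conj
        ((𝓕 (conjH1 w).weakDeriv : L2R) ξ)) :=
    L2R.integrable_mul _ (Lp.memLp _).star
  refine (hasDerivAt_integral_of_dominated_loc_of_deriv_le (s := univ)
    (F' := fun x ξ => conj (p ξ) * (-(4 * Real.pi ^ 2 * ξ ^ 2) * Complex.I * schrSymbol x ξ * q ξ))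
    univ_mem (Eventually.of_forall hm) ?_ ?_ (hb.mono fun ξ h x _ => (h x).le) hi.norm
    (Eventually.of_forall fun ξ x _ => ?_)).2
  · refine (L2R.integrable_mul q (Lp.memLp p).star).mono (hm z) (Eventually.of_forall fun ξ => ?_)
    simp [mul_comm]
  · refine (Lp.memLp p).star.aestronglyMeasurable.mul (AEStronglyMeasurable.mul ?_
      (Lp.aestronglyMeasurable q))
    refine Continuous.aestronglyMeasurable ?_
    have := continuous_schrSymbol z
    fun_prop
  · exact ((hasDerivAt_schrSymbol x ξ).mul_const (q ξ)).const_mul (conj (p ξ))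

/-- The derivative tested on each `w` becomes a norm derivative because the curve is the integral of
a norm-continuous `H⁻¹`-valued function. -/
theorem hasDerivAt_ofH1_schr (u : H1R) (z : ℝ) :
    HasDerivAt (fun z => HNeg1R.ofH1 (schr z u)) (Complex.I • (schr z u).secondDeriv) z := by
  have hc : Continuous fun z => Complex.I • (schr z u).secondDeriv :=
    (HNeg1R.secondDerivCLM.continuous.comp (continuous_schr u)).const_smul Complex.I
  have e : (fun z => HNeg1R.ofH1 (schr z u)) = fun z =>
      HNeg1R.ofH1 (schr 0 u) + ∫ s in (0 : ℝ)..z, Complex.I • (schr s u).secondDeriv := by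
    ext z w
    have h1 := intervalIntegral.integral_eq_sub_of_hasDerivAt (a := 0) (b := z)
      (fun s _ => hasDerivAt_ofH1_schr_apply u w s)
      ((hc.clm_apply continuous_const).intervalIntegrable _ _)
    have h2 := ContinuousLinearMap.intervalIntegral_apply (μ := volume) (hc.intervalIntegrable 0 z) w
    rw [add_apply, h2]
    change _ = _ + ∫ s in (0 : ℝ)..z, Complex.I * (schr s u).secondDeriv w
    rw [h1]
    ring
  rw [e]
  exact (hc.integral_hasStrictDerivAt 0 z).hasDerivAt.const_add _

/-- The derivative in `H⁻¹` of `S(z) y(z)`, where `y` is differentiable in `H¹`. -/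
theorem hasDerivWithinAt_ofH1_schr {y : ℝ → H1R} {y' : H1R} {J : Set ℝ} {s : ℝ}
    (hy : HasDerivWithinAt y y' J s) :
    HasDerivWithinAt (fun x => HNeg1R.ofH1 (schr x (y x)))
      (Complex.I • (schr s (y s)).secondDeriv + HNeg1R.ofH1 (schr s y')) J s := by
  -- Split `S(x)y(x) - S(s)y(s)` as `(S(x) - S(s))y(s) + S(x)(y(x) - y(s))`; joint continuity of the
  -- group handles the second slope.
  have h1 := hasDerivWithinAt_iff_tendsto_slope.1
    ((hasDerivAt_ofH1_schr (y s) s).hasDerivWithinAt (s := J))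
  have h2 := hasDerivWithinAt_iff_tendsto_slope.1 hy
  have h3 : Tendsto (fun x : ℝ => x) (𝓝[J \ {s}] s) (𝓝 s) := tendsto_id.mono_left nhdsWithin_le_nhds
  have h4 := (HNeg1R.ofH1CLM.continuous.tendsto _).comp (tendsto_schr h3 h2)
  rw [hasDerivWithinAt_iff_tendsto_slope]
  refine (h1.add h4).congr fun x => ?_
  simp only [slope, vsub_eq_sub, Function.comp, ← HNeg1R.ofH1CLM_apply]
  have e : schr x ((x - s)⁻¹ • (y x - y s)) = (x - s)⁻¹ • schr x (y x - y s) :=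
    (schr x).toLinearMap.map_smul_of_tower _ _
  rw [e, ContinuousLinearMap.map_smul_of_tower, map_sub, map_sub,
    ← smul_add]
  congr 1
  abel

end H1R

/-! ### Grönwall, and functionals along curves differentiable in `H⁻¹` -/

/-- Grönwall's inequality on an interval with endpoint `0`, in either direction. -/
theorem le_mul_exp_of_abs_deriv_le {f f' : ℝ → ℝ} {z K : ℝ}
    (hf : ∀ s ∈ uIcc 0 z, HasDerivWithinAt f (f' s) (uIcc 0 z) s)
    (hb : ∀ s ∈ uIcc 0 z, |f' s| ≤ K * f s) : f z ≤ f 0 * Real.exp (K * |z|) := by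
  have key : ∀ {f f' : ℝ → ℝ} {z : ℝ}, 0 ≤ z →
      (∀ s ∈ Icc 0 z, HasDerivWithinAt f (f' s) (Icc 0 z) s) →
      (∀ s ∈ Icc 0 z, |f' s| ≤ K * f s) → f z ≤ f 0 * Real.exp (K * z) := by
    intro f f' z hz hf hb
    have hd : ∀ s ∈ Icc 0 z, HasDerivWithinAt (fun s => f s * Real.exp (-(K * s)))
        (f' s * Real.exp (-(K * s)) + f s * (Real.exp (-(K * s)) * -(K * 1))) (Icc 0 z) s :=
      fun s hs => (hf s hs).mul
        ((((hasDerivAt_id s).const_mul K).neg.exp).hasDerivWithinAt)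
    have ha : AntitoneOn (fun s => f s * Real.exp (-(K * s))) (Icc 0 z) := by
      refine antitoneOn_of_hasDerivWithinAt_nonpos (convex_Icc 0 z)
        (fun s hs => (hd s hs).continuousWithinAt)
        (fun s hs => (hd s (interior_subset hs)).mono interior_subset) fun s hs => ?_
      have h1 := (abs_le.1 (hb s (interior_subset hs))).2
      have h2 := Real.exp_pos (-(K * s))
      nlinarith
    have h := ha ⟨le_rfl, hz⟩ ⟨hz, le_rfl⟩ hz
    simp only [mul_zero, neg_zero, Real.exp_zero, mul_one, Real.exp_neg] at h
    rwa [← div_eq_mul_inv, div_le_iff₀ (Real.exp_pos _)] at h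
  rcases le_total 0 z with hz | hz
  · rw [uIcc_of_le hz] at hf hb
    rw [abs_of_nonneg hz]
    exact key hz hf hb
  · rw [uIcc_of_ge hz] at hf hb
    rw [abs_of_nonpos hz]
    have hm : MapsTo (fun s : ℝ => -s) (Icc 0 (-z)) (Icc z 0) := fun s hs =>
      ⟨by linarith [hs.2], by linarith [hs.1]⟩
    have h := key (f := fun s => f (-s)) (f' := fun s => f' (-s) * -1) (z := -z) (by linarith)
      (fun s hs => (hf (-s) (hm hs)).comp s (hasDerivAt_neg s).hasDerivWithinAt hm)
      (fun s hs => by simpa using hb (-s) (hm hs))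
    simpa using h

/-- A chain rule for the duality pairing between `H⁻¹` and `H¹`, in terms of exact differences. -/
theorem hasDerivWithinAt_of_sub_eq_re_apply {f : ℝ → ℝ} {p : ℝ → HNeg1R} {p' : HNeg1R}
    {q : ℝ → H1R} {J : Set ℝ} {s : ℝ} (hp : HasDerivWithinAt p p' J s)
    (hq : ContinuousWithinAt q J s) (h : ∀ x, f x - f s = ((p x - p s) (q x)).re) :
    HasDerivWithinAt f (p' (q s)).re J s := by
  rw [hasDerivWithinAt_iff_tendsto_slope] at hp ⊢
  have hq' : Tendsto q (𝓝[J \ {s}] s) (𝓝 (q s)) := hq.mono_left (nhdsWithin_mono _ sdiff_subset)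
  have h1 := (Complex.continuous_re.tendsto _).comp
    (((isBoundedBilinearMap_apply (𝕜 := ℂ) (E := H1R) (F := ℂ)).continuous.tendsto (p', q s)).comp
      (hp.prodMk_nhds hq'))
  refine h1.congr fun x => ?_
  simp only [slope, vsub_eq_sub, Function.comp, h, smul_apply, Complex.smul_re]

namespace H1R

theorem ofH1_conjH1 (u v : H1R) : HNeg1R.ofH1 u (conjH1 v) = inner ℂ v.toL2 u.toL2 := by
  rw [HNeg1R.ofH1_apply, toL2_conjH1, pairL2_conjL2]

theorem ofL2_conjH1 (f : L2R) (v : H1R) : HNeg1R.ofL2 f (conjH1 v) = inner ℂ v.toL2 f := by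
  rw [HNeg1R.ofL2_apply, toL2_conjH1, pairL2_conjL2]

theorem secondDeriv_conjH1 (u v : H1R) :
    u.secondDeriv (conjH1 v) = -inner ℂ v.weakDeriv u.weakDeriv := by
  rw [HNeg1R.secondDeriv_apply, weakDeriv_conjH1, pairL2_conjL2]

theorem ofH1_sub_ofH1 (u v : H1R) : HNeg1R.ofH1 u - HNeg1R.ofH1 v = HNeg1R.ofH1 (u - v) :=
  (map_sub HNeg1R.ofH1CLM u v).symm

theorem norm_sq_sub_norm_sq (a b : L2R) :
    ‖a‖ ^ 2 - ‖b‖ ^ 2 = (inner ℂ (a + b) (a - b)).re := by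
  have h1 : (inner ℂ a a).re = ‖a‖ ^ 2 := inner_self_eq_norm_sq (𝕜 := ℂ) a
  have h2 : (inner ℂ b b).re = ‖b‖ ^ 2 := inner_self_eq_norm_sq (𝕜 := ℂ) b
  have h3 : (inner ℂ a b).re = (inner ℂ b a).re := inner_re_symm (𝕜 := ℂ) a b
  simp only [inner_add_left, inner_sub_right, Complex.add_re, Complex.sub_re]
  linarith

/-- The derivative of the `L²` norm along a curve which is `C¹` in `H⁻¹`. -/
theorem hasDerivWithinAt_norm_toL2_sq {d : ℝ → H1R} {p' : HNeg1R} {J : Set ℝ} {s : ℝ}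
    (hp : HasDerivWithinAt (fun x => HNeg1R.ofH1 (d x)) p' J s) (hd : ContinuousWithinAt d J s) :
    HasDerivWithinAt (fun x => ‖(d x).toL2‖ ^ 2) (2 * (p' (conjH1 (d s))).re) J s := by
  have h := hasDerivWithinAt_of_sub_eq_re_apply (f := fun x => ‖(d x).toL2‖ ^ 2)
    (q := fun x => conjH1 (d x + d s)) hp
    (conjH1.continuous.continuousAt.comp_continuousWithinAt (hd.add continuousWithinAt_const))
    (fun x => by rw [norm_sq_sub_norm_sq, ofH1_sub_ofH1, ofH1_conjH1, map_add, map_sub])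
  convert h using 1
  rw [map_add, map_add, Complex.add_re, two_mul]

/-- The quartic functional `∫ |u|⁴`. -/
def quartic (u : H1R) : ℝ := ‖(absSq u).toL2‖ ^ 2

theorem quartic_nonneg (u : H1R) : 0 ≤ quartic u := sq_nonneg _

/-- Pointwise, `|u|⁴ - |v|⁴ = (|u|² + |v|²) Re((u - v) conj(u + v))`. This form pairs an increment,
differentiable in `H⁻¹`, with a factor that is merely continuous in `H¹`. -/
theorem quartic_sub (u v : H1R) : quartic u - quartic v =
    (HNeg1R.ofH1 (u - v) (mul (absSq u + absSq v) (conjH1 (u + v)))).re := by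
  rw [quartic, quartic, norm_sq_sub_norm_sq, inner_eq_integral, HNeg1R.ofH1_apply, pairL2_apply]
  have hre : ∀ {F G : ℝ → ℂ}, Integrable F → Integrable G → (∀ᵐ t, (F t).re = (G t).re) →
      (∫ t, F t).re = (∫ t, G t).re := by
    intro F G hF hG h
    have e : ∀ {F : ℝ → ℂ}, Integrable F → (∫ t, F t).re = ∫ t, (F t).re := fun hF =>
      (integral_re hF).symm
    rw [e hF, e hG]
    exact integral_congr_ae h
  refine hre ?_ (L2R.integrable_mul _ (Lp.memLp _)) ?_
  · exact (L2R.integrable_mul ((absSq u).toL2 - (absSq v).toL2)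
      (Lp.memLp ((absSq u).toL2 + (absSq v).toL2)).star).congr
        (Eventually.of_forall fun t => mul_comm _ _)
  · rw [← map_add, ← map_sub]
    filter_upwards [coeFn_mul (absSq u + absSq v) (conjH1 (u + v)),
      coeFn_conjL2 (u + v).toL2, Lp.coeFn_sub u.toL2 v.toL2, Lp.coeFn_add u.toL2 v.toL2,
      Lp.coeFn_sub (absSq u).toL2 (absSq v).toL2, Lp.coeFn_add (absSq u).toL2 (absSq v).toL2,
      coeFn_absSq u, coeFn_absSq v] with t h1 h2 h3 h4 h5 h6 h7 h8
    rw [h1, toL2_conjH1, h2]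
    simp only [map_add, map_sub, h3, h4, h5, h6, Pi.add_apply, Pi.sub_apply, h7, h8,
      ← Complex.normSq_eq_norm_sq, Complex.normSq_apply]
    simp
    ring

theorem mul_absSq_conjH1 (u : H1R) :
    mul (absSq u + absSq u) (conjH1 (u + u)) = (4 : ℂ) • conjH1 (cubic u) := by
  apply ext_toL2
  rw [map_smul, ← two_smul ℂ (absSq u), ← two_smul ℂ u, map_smul, map_smulₛₗ, map_smul, smul_apply,
    smul_smul, map_smul]
  have : (conj (2 : ℂ)) * 2 = 4 := by rw [Complex.conj_ofNat]; norm_num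
  rw [this]
  congr 1
  refine Lp.ext ?_
  filter_upwards [coeFn_mul (absSq u) (conjH1 u), coeFn_conjL2 u.toL2,
    coeFn_conjL2 (cubic u).toL2, coeFn_cubic u, coeFn_absSq u] with t h1 h2 h3 h4 h5
  rw [h1, toL2_conjH1, toL2_conjH1, h2, h3, h4, h5, map_mul, Complex.conj_ofReal]

/-- The derivative of `∫ |v|⁴` along a curve which is `C¹` in `H⁻¹`. -/
theorem hasDerivWithinAt_quartic {v : ℝ → H1R} {p' : HNeg1R} {J : Set ℝ} {s : ℝ}
    (hp : HasDerivWithinAt (fun x => HNeg1R.ofH1 (v x)) p' J s) (hv : ContinuousWithinAt v J s) :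
    HasDerivWithinAt (fun x => quartic (v x)) (4 * (p' (conjH1 (cubic (v s)))).re) J s := by
  have hq : Continuous fun u => mul (absSq u + absSq (v s)) (conjH1 (u + v s)) :=
    (mul.continuous.comp (continuous_absSq.add continuous_const)).clm_apply
      (conjH1.continuous.comp (continuous_id.add continuous_const))
  have h := hasDerivWithinAt_of_sub_eq_re_apply (f := fun x => quartic (v x))
    (q := fun x => mul (absSq (v x) + absSq (v s)) (conjH1 (v x + v s))) hp
    (hq.continuousAt.comp_continuousWithinAt hv)
    (fun x => by rw [ofH1_sub_ofH1, quartic_sub])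
  convert h using 1
  rw [mul_absSq_conjH1, map_smul]
  simp

theorem inner_cubic_im (u : H1R) : (inner ℂ u.toL2 (cubic u).toL2).im = 0 := by
  have e : inner ℂ u.toL2 (cubic u).toL2 = ((∫ t, ‖u.toL2 t‖ ^ 4 : ℝ) : ℂ) := by
    rw [inner_eq_integral, ← integral_complex_ofReal]
    refine integral_congr_ae ?_
    filter_upwards [coeFn_cubic u] with t ht
    rw [ht, mul_left_comm, mul_comm (conj _), Complex.mul_conj, Complex.normSq_eq_norm_sq]
    push_cast
    ring
  rw [e, Complex.ofReal_im]

/-- One factor `|u|²` of `|u|⁴` is bounded uniformly by Gagliardo–Nirenberg and the other is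
integrated. -/
theorem quartic_le (u : H1R) :
    quartic u ≤ 2 * (‖u.toL2‖ * ‖u.weakDeriv‖) * ‖u.toL2‖ ^ 2 := by
  set B := 2 * (‖u.toL2‖ * ‖u.weakDeriv‖)
  have hB : 0 ≤ B := by positivity
  have h : ‖(absSq u).toL2‖ ≤ √B * ‖u.toL2‖ := by
    refine Lp.norm_le_mul_norm_of_ae_le_mul ?_
    filter_upwards [coeFn_absSq u, u.ae_norm_sq_le] with t h1 h2
    rw [h1, Complex.norm_real, Real.norm_of_nonneg (by positivity), sq]
    exact mul_le_mul_of_nonneg_right (Real.le_sqrt_of_sq_le h2) (norm_nonneg _)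
  calc quartic u ≤ (√B * ‖u.toL2‖) ^ 2 := pow_le_pow_left₀ (norm_nonneg _) h 2
    _ = B * ‖u.toL2‖ ^ 2 := by rw [mul_pow, Real.sq_sqrt hB]

end H1R

open H1R

/-! ### The equation in `H⁻¹` and uniqueness -/

/-- The coefficient `C₁ e^{-C₂ z}` of the nonlinearity. -/
def nlsCoeff (C₁ C₂ z : ℝ) : ℝ := C₁ * Real.exp (-C₂ * z)

theorem continuous_nlsCoeff (C₁ C₂ : ℝ) : Continuous (nlsCoeff C₁ C₂) := by
  unfold nlsCoeff; fun_prop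

theorem hasDerivAt_nlsCoeff (C₁ C₂ z : ℝ) :
    HasDerivAt (nlsCoeff C₁ C₂) (-C₂ * nlsCoeff C₁ C₂ z) z := by
  have h := (((hasDerivAt_id z).const_mul (-C₂)).exp).const_mul C₁
  have e : -C₂ * nlsCoeff C₁ C₂ z = C₁ * (Real.exp (-C₂ * z) * (-C₂ * 1)) := by
    rw [nlsCoeff]; ring
  rw [e]
  exact h

theorem abs_nlsCoeff_le {C₁ C₂ z T : ℝ} (hC₁ : C₁ = 1 ∨ C₁ = -1) (hC₂ : 0 < C₂) (hz : |z| ≤ T) :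
    |nlsCoeff C₁ C₂ z| ≤ Real.exp (C₂ * T) := by
  have h1 : |C₁| = 1 := by rcases hC₁ with h | h <;> simp [h]
  rw [nlsCoeff, abs_mul, h1, one_mul, Real.abs_exp]
  apply Real.exp_le_exp.2
  nlinarith [neg_abs_le z]

/-- The right hand side of the equation solved for `v_z`, as an element of `H⁻¹`. -/
def nlsField (C₁ C₂ z : ℝ) (u : H1R) : HNeg1R :=
  Complex.I • (u.secondDeriv + (nlsCoeff C₁ C₂ z : ℂ) • HNeg1R.ofL2 (cubic u).toL2)

theorem nlsField_conjH1 (C₁ C₂ z : ℝ) (u w : H1R) : nlsField C₁ C₂ z u (conjH1 w) =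
    Complex.I * (-inner ℂ w.weakDeriv u.weakDeriv +
      nlsCoeff C₁ C₂ z * inner ℂ w.toL2 (cubic u).toL2) := by
  rw [← ofL2_conjH1, ← secondDeriv_conjH1]
  rfl

theorem continuousOn_nlsField (C₁ C₂ : ℝ) {v : ℝ → H1R} {I : Set ℝ} (hv : ContinuousOn v I) :
    ContinuousOn (fun z => nlsField C₁ C₂ z (v z)) I := by
  have h1 : ContinuousOn (fun z => HNeg1R.secondDerivCLM (v z)) I :=
    HNeg1R.secondDerivCLM.continuous.comp_continuousOn hv
  have h2 : ContinuousOn (fun z => HNeg1R.ofH1CLM (cubic (v z))) I :=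
    (HNeg1R.ofH1CLM.continuous.comp continuous_cubic).comp_continuousOn hv
  have h3 : ContinuousOn (fun z => (nlsCoeff C₁ C₂ z : ℂ)) I :=
    (Complex.continuous_ofReal.comp (continuous_nlsCoeff C₁ C₂)).continuousOn
  exact (h1.add (h3.smul h2)).const_smul Complex.I

/-- The class `N` is forced almost everywhere, and multiplication by `-i` solves for `v_z`.
Continuity of `v_z` is then automatic from continuity of `v` in `H¹`. -/
theorem isH1Solution_iff {C₁ C₂ : ℝ} {φ : H1R} {I : Set ℝ} {v : ℝ → H1R} :
    IsH1Solution C₁ C₂ φ I v ↔ ContinuousOn v I ∧ v 0 = φ ∧ ∀ z ∈ I,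
      HasDerivWithinAt (fun s => HNeg1R.ofH1 (v s)) (nlsField C₁ C₂ z (v z)) I z := by
  constructor
  · rintro ⟨hc, h0, vz, -, hvz⟩
    refine ⟨hc, h0, fun z hz => ?_⟩
    obtain ⟨hd, N, hN, heq⟩ := hvz z hz
    have hN' : N = (nlsCoeff C₁ C₂ z : ℂ) • (cubic (v z)).toL2 := by
      refine Lp.ext ?_
      filter_upwards [hN, coeFn_cubic (v z),
        Lp.coeFn_smul (nlsCoeff C₁ C₂ z : ℂ) (cubic (v z)).toL2] with t h1 h2 h3
      rw [h1, h3, Pi.smul_apply, h2, smul_eq_mul]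
      rfl
    convert hd using 1
    ext w
    have h := heq w
    have e : HNeg1R.ofL2 N w =
        (nlsCoeff C₁ C₂ z : ℂ) * HNeg1R.ofL2 (cubic (v z)).toL2 w := by
      rw [HNeg1R.ofL2_apply, HNeg1R.ofL2_apply, hN', map_smul]
      rfl
    rw [e] at h
    change Complex.I * ((v z).secondDeriv w +
      (nlsCoeff C₁ C₂ z : ℂ) * HNeg1R.ofL2 (cubic (v z)).toL2 w) = vz z w
    linear_combination Complex.I * h - vz z w * Complex.I_sq
  · rintro ⟨hc, h0, hd⟩
    refine ⟨hc, h0, fun z => nlsField C₁ C₂ z (v z), continuousOn_nlsField C₁ C₂ hc,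
      fun z hz => ⟨hd z hz, (nlsCoeff C₁ C₂ z : ℂ) • (cubic (v z)).toL2, ?_, fun w => ?_⟩⟩
    · filter_upwards [coeFn_cubic (v z),
        Lp.coeFn_smul (nlsCoeff C₁ C₂ z : ℂ) (cubic (v z)).toL2] with t h2 h3
      rw [h3, Pi.smul_apply, h2, smul_eq_mul]
      rfl
    · have e : HNeg1R.ofL2 ((nlsCoeff C₁ C₂ z : ℂ) • (cubic (v z)).toL2) w =
          (nlsCoeff C₁ C₂ z : ℂ) * HNeg1R.ofL2 (cubic (v z)).toL2 w := by
        rw [HNeg1R.ofL2_apply, HNeg1R.ofL2_apply, map_smul]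
        rfl
      rw [e]
      change Complex.I * (Complex.I * ((v z).secondDeriv w +
        (nlsCoeff C₁ C₂ z : ℂ) * HNeg1R.ofL2 (cubic (v z)).toL2 w)) + _ + _ = 0
      linear_combination ((v z).secondDeriv w +
        (nlsCoeff C₁ C₂ z : ℂ) * HNeg1R.ofL2 (cubic (v z)).toL2 w) * Complex.I_sq

theorem IsH1Solution.mono {C₁ C₂ : ℝ} {φ : H1R} {I J : Set ℝ} {v : ℝ → H1R}
    (h : IsH1Solution C₁ C₂ φ I v) (hJ : J ⊆ I) : IsH1Solution C₁ C₂ φ J v := by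
  rw [isH1Solution_iff] at h ⊢
  exact ⟨h.1.mono hJ, h.2.1, fun z hz => (h.2.2 z (hJ hz)).mono hJ⟩

/-- Unconditional uniqueness of `H¹`-solutions. -/
theorem IsH1Solution.eqOn {C₁ C₂ : ℝ} (hC₁ : C₁ = 1 ∨ C₁ = -1) (hC₂ : 0 < C₂) {φ : H1R}
    {I : Set ℝ} (hI : I.OrdConnected) (h0 : (0 : ℝ) ∈ I) {v w : ℝ → H1R}
    (hv : IsH1Solution C₁ C₂ φ I v) (hw : IsH1Solution C₁ C₂ φ I w) : EqOn v w I := by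
  intro z hz
  have hJ : uIcc 0 z ⊆ I := hI.uIcc_subset h0 hz
  obtain ⟨cv, iv, dv⟩ := isH1Solution_iff.1 (hv.mono hJ)
  obtain ⟨cw, iw, dw⟩ := isH1Solution_iff.1 (hw.mono hJ)
  obtain ⟨R₁, hR₁⟩ := isCompact_uIcc.exists_bound_of_continuousOn cv
  obtain ⟨R₂, hR₂⟩ := isCompact_uIcc.exists_bound_of_continuousOn cw
  set R := max R₁ R₂
  have habs : ∀ s ∈ uIcc 0 z, |s| ≤ |z| := fun s hs => by
    simpa using abs_sub_left_of_mem_uIcc hs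
  have hd : ∀ s ∈ uIcc 0 z, HasDerivWithinAt (fun x => ‖(v x - w x).toL2‖ ^ 2)
      (2 * ((nlsField C₁ C₂ s (v s) - nlsField C₁ C₂ s (w s)) (conjH1 (v s - w s))).re)
      (uIcc 0 z) s := by
    intro s hs
    refine hasDerivWithinAt_norm_toL2_sq (d := fun x => v x - w x) ?_
      ((cv s hs).sub (cw s hs))
    have := (dv s hs).sub (dw s hs)
    refine this.congr (fun x _ => ?_) ?_ <;> exact (ofH1_sub_ofH1 _ _).symm
  have hb : ∀ s ∈ uIcc 0 z,
      |2 * ((nlsField C₁ C₂ s (v s) - nlsField C₁ C₂ s (w s)) (conjH1 (v s - w s))).re| ≤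
        (2 * (Real.exp (C₂ * |z|) * (3 * R ^ 2))) * ‖(v s - w s).toL2‖ ^ 2 := by
    intro s hs
    set d := v s - w s
    have e : (nlsField C₁ C₂ s (v s) - nlsField C₁ C₂ s (w s)) (conjH1 d) =
        -(Complex.I * inner ℂ d.weakDeriv d.weakDeriv) + Complex.I * nlsCoeff C₁ C₂ s *
          inner ℂ d.toL2 ((cubic (v s)).toL2 - (cubic (w s)).toL2) := by
      rw [sub_apply, nlsField_conjH1, nlsField_conjH1, inner_sub_right,
        show d.weakDeriv = (v s).weakDeriv - (w s).weakDeriv from map_sub _ _ _]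
      simp only [inner_sub_right]
      ring
    -- The dispersive term is `i` times a real number, so only the nonlinearity moves the `L²` norm
    -- of the difference.
    have e1 : (Complex.I * inner ℂ d.weakDeriv d.weakDeriv).re = 0 := by
      have : (inner ℂ d.weakDeriv d.weakDeriv).im = 0 := inner_self_im (𝕜 := ℂ) d.weakDeriv
      rw [Complex.mul_re, this]
      simp
    rw [e, Complex.add_re, Complex.neg_re, e1, neg_zero, zero_add, abs_mul, abs_two,
      mul_assoc (2 : ℝ), mul_assoc (Real.exp _)]
    refine mul_le_mul_of_nonneg_left ?_ two_pos.le
    refine (Complex.abs_re_le_norm _).trans ?_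
    rw [norm_mul, norm_mul, Complex.norm_I, one_mul, Complex.norm_real,
      Real.norm_eq_abs]
    refine mul_le_mul (abs_nlsCoeff_le hC₁ hC₂ (habs s hs)) ?_ (norm_nonneg _) (Real.exp_pos _).le
    have h1 := norm_toL2_cubic_sub_le ((hR₁ s hs).trans (le_max_left R₁ R₂))
      ((hR₂ s hs).trans (le_max_right R₁ R₂))
    rw [← map_sub toL2 (v s)] at h1
    calc _ ≤ ‖d.toL2‖ * ‖(cubic (v s)).toL2 - (cubic (w s)).toL2‖ := norm_inner_le_norm _ _
      _ ≤ ‖d.toL2‖ * (3 * R ^ 2 * ‖d.toL2‖) := by gcongr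
      _ = _ := by ring
  have h := le_mul_exp_of_abs_deriv_le hd hb
  simp only [iv, iw, sub_self, map_zero, norm_zero] at h
  have h' : ‖(v z - w z).toL2‖ = 0 := by
    rw [zero_pow two_ne_zero, zero_mul] at h
    exact pow_eq_zero_iff two_ne_zero |>.1 (le_antisymm h (sq_nonneg _))
  exact sub_eq_zero.1 (ext_toL2 (by rw [norm_eq_zero.1 h', map_zero]))

/-! ### Interaction picture and a priori bound -/

/-- The vector field of the equation in the interaction picture `y(z) = S(-z) v(z)`. -/
def interactionField (C₁ C₂ z : ℝ) (y : H1R) : H1R :=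
  schr (-z) ((Complex.I * nlsCoeff C₁ C₂ z) • cubic (schr z y))

theorem hasDerivWithinAt_ofH1_of_interaction {C₁ C₂ : ℝ} {y : ℝ → H1R} {J : Set ℝ} {s : ℝ}
    (hy : HasDerivWithinAt y (interactionField C₁ C₂ s (y s)) J s) :
    HasDerivWithinAt (fun x => HNeg1R.ofH1 (schr x (y x)))
      (nlsField C₁ C₂ s (schr s (y s))) J s := by
  convert hasDerivWithinAt_ofH1_schr hy using 1
  rw [interactionField, schr_schr_neg, nlsField, smul_add, smul_smul]
  congr 1
  exact (map_smul HNeg1R.ofH1CLM _ _).symm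

theorem continuousWithinAt_schr {y : ℝ → H1R} {J : Set ℝ} {s : ℝ} (hy : ContinuousWithinAt y J s) :
    ContinuousWithinAt (fun x => schr x (y x)) J s :=
  tendsto_schr (tendsto_id.mono_left nhdsWithin_le_nhds) hy

theorem isH1Solution_of_interaction {C₁ C₂ : ℝ} {φ : H1R} {y : ℝ → H1R} {J : Set ℝ} (h0 : y 0 = φ)
    (hy : ∀ s ∈ J, HasDerivWithinAt y (interactionField C₁ C₂ s (y s)) J s) :
    IsH1Solution C₁ C₂ φ J (fun s => schr s (y s)) :=
  isH1Solution_iff.2 ⟨fun s hs => continuousWithinAt_schr (hy s hs).continuousWithinAt,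
    by simp [h0], fun s hs => hasDerivWithinAt_ofH1_of_interaction (hy s hs)⟩

/-- The `L²` norm of a solution does not grow. -/
theorem IsH1Solution.norm_toL2_le {C₁ C₂ : ℝ} {φ : H1R} {z : ℝ} {v : ℝ → H1R}
    (hv : IsH1Solution C₁ C₂ φ (uIcc 0 z) v) : ‖(v z).toL2‖ ≤ ‖φ.toL2‖ := by
  obtain ⟨cv, iv, dv⟩ := isH1Solution_iff.1 hv
  -- Both terms paired with `conj v` are `i` times real numbers, so the derivative vanishes and
  -- Grönwall applies with rate `0`.
  have h := le_mul_exp_of_abs_deriv_le (K := 0)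
    (fun s hs => hasDerivWithinAt_norm_toL2_sq (dv s hs) (cv s hs)) (fun s hs => by
      have h1 : (inner ℂ (v s).weakDeriv (v s).weakDeriv).im = 0 :=
        inner_self_im (𝕜 := ℂ) (v s).weakDeriv
      rw [nlsField_conjH1, Complex.mul_re, Complex.add_im, Complex.neg_im, h1, Complex.im_ofReal_mul,
        inner_cubic_im]
      simp)
  rw [zero_mul, Real.exp_zero, mul_one, iv] at h
  exact abs_le_of_sq_le_sq' h (norm_nonneg _) |>.2

/-- The derivative of the squared gradient norm in the interaction picture. -/
theorem hasDerivWithinAt_norm_weakDeriv_sq {C₁ C₂ : ℝ} {y : ℝ → H1R} {J : Set ℝ} {s : ℝ}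
    (hy : HasDerivWithinAt y (interactionField C₁ C₂ s (y s)) J s) :
    HasDerivWithinAt (fun x => ‖(y x).weakDeriv‖ ^ 2)
      (2 * (nlsCoeff C₁ C₂ s * (nlsField C₁ C₂ s (schr s (y s))
        (conjH1 (cubic (schr s (y s))))).re)) J s := by
  -- The curve `y` is differentiable in `H¹` itself and `‖y_t‖ = ‖v_t‖`, so the energy computation
  -- needs no regularization.
  have h1 : HasDerivWithinAt (fun x => (y x).weakDeriv)
      (interactionField C₁ C₂ s (y s)).weakDeriv J s :=
    (weakDeriv.restrictScalars ℝ).hasFDerivAt.comp_hasDerivWithinAt s hy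
  have h2 := Complex.reCLM.hasFDerivAt.comp_hasDerivWithinAt s (h1.inner ℂ h1)
  have e : (fun x => ‖(y x).weakDeriv‖ ^ 2) =
      fun x => Complex.reCLM (inner ℂ (y x).weakDeriv (y x).weakDeriv) := by
    ext x
    exact (inner_self_eq_norm_sq (𝕜 := ℂ) (y x).weakDeriv).symm
  rw [e]
  refine h2.congr_deriv ?_
  set v := schr s (y s)
  have e1 : inner ℂ (y s).weakDeriv (interactionField C₁ C₂ s (y s)).weakDeriv =
      Complex.I * nlsCoeff C₁ C₂ s * inner ℂ v.weakDeriv (cubic v).weakDeriv := by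
    rw [← LinearIsometry.inner_map_map (schrL2 s) (y s).weakDeriv, ← weakDeriv_schr,
      ← weakDeriv_schr, interactionField, schr_schr_neg, map_smul, inner_smul_right]
  have e2 : (inner ℂ (interactionField C₁ C₂ s (y s)).weakDeriv (y s).weakDeriv).re =
      (inner ℂ (y s).weakDeriv (interactionField C₁ C₂ s (y s)).weakDeriv).re :=
    inner_re_symm (𝕜 := ℂ) _ _
  -- The purely imaginary term from `c ‖|v|²v‖²` can be added freely. It completes the same pairing
  -- as in the derivative of `quartic`, so the two cancel in the energy.
  have e3 : (inner ℂ (cubic v).toL2 (cubic v).toL2).im = 0 := inner_self_im (𝕜 := ℂ) (cubic v).toL2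
  have e4 : (inner ℂ (cubic v).weakDeriv v.weakDeriv).im =
      -(inner ℂ v.weakDeriv (cubic v).weakDeriv).im := inner_im_symm (𝕜 := ℂ) _ _
  rw [Complex.reCLM_apply, Complex.add_re, e2, e1, nlsField_conjH1, mul_assoc, Complex.I_mul_re,
    Complex.I_mul_re, Complex.add_im, Complex.neg_im, Complex.im_ofReal_mul, Complex.im_ofReal_mul,
    e3, e4]
  ring

/-- The a priori bound for the square of the `H¹` norm on `[-T, T]`. -/
def aprioriBound (C₂ : ℝ) (φ : H1R) (T : ℝ) : ℝ :=
  ‖φ.toL2‖ ^ 2 + (3 * ‖φ.weakDeriv‖ ^ 2 + 3 * Real.exp (C₂ * T) ^ 2 * ‖φ.toL2‖ ^ 6) *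
    Real.exp (C₂ * T)

theorem norm_sq_le_aprioriBound {C₁ C₂ : ℝ} (hC₁ : C₁ = 1 ∨ C₁ = -1) (hC₂ : 0 < C₂) {φ : H1R}
    {y : ℝ → H1R} {z T : ℝ} (hz : |z| ≤ T) (h0 : y 0 = φ)
    (hy : ∀ s ∈ uIcc 0 z,
      HasDerivWithinAt y (interactionField C₁ C₂ s (y s)) (uIcc 0 z) s) :
    ‖y z‖ ^ 2 ≤ aprioriBound C₂ φ T := by
  have hsub : ∀ s ∈ uIcc 0 z, uIcc 0 s ⊆ uIcc 0 z := fun s hs =>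
    uIcc_subset_uIcc left_mem_uIcc hs
  have hsol := isH1Solution_of_interaction h0 hy
  have hmass : ∀ s ∈ uIcc 0 z, ‖(y s).toL2‖ ≤ ‖φ.toL2‖ := fun s hs => by
    simpa using (hsol.mono (hsub s hs)).norm_toL2_le
  set K := Real.exp (C₂ * T)
  set m := ‖φ.toL2‖
  -- Chosen for Young's inequality: `2 K m³ x ≤ x² + K² m⁶ = x² + 2B`, with `x` the gradient norm.
  set B := K ^ 2 * m ^ 6 / 2
  have hm : 0 ≤ m := norm_nonneg _
  have hK : 0 < K := Real.exp_pos _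
  have hB : 0 ≤ B := by positivity
  set c := nlsCoeff C₁ C₂
  set Q : ℝ → ℝ := fun s => quartic (schr s (y s))
  set a : ℝ → ℝ := fun s => ‖(y s).weakDeriv‖ ^ 2
  have hpot : ∀ s ∈ uIcc 0 z, |c s * Q s| ≤ a s + 2 * B := by
    intro s hs
    have h1 : |c s| ≤ K := by
      refine abs_nlsCoeff_le hC₁ hC₂ (le_trans ?_ hz)
      simpa using abs_sub_left_of_mem_uIcc hs
    have h2 : Q s ≤ 2 * m ^ 3 * ‖(y s).weakDeriv‖ := by
      refine (quartic_le _).trans ?_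
      rw [toL2_schr, weakDeriv_schr, LinearIsometry.norm_map, LinearIsometry.norm_map]
      have := hmass s hs
      calc _ ≤ 2 * (m * ‖(y s).weakDeriv‖) * m ^ 2 := by gcongr
        _ = _ := by ring
    have h3 : 0 ≤ Q s := quartic_nonneg _
    rw [abs_mul, abs_of_nonneg h3]
    calc |c s| * Q s ≤ K * (2 * m ^ 3 * ‖(y s).weakDeriv‖) := by gcongr
      _ ≤ a s + 2 * B := by
        simp only [a, B]
        nlinarith [sq_nonneg (‖(y s).weakDeriv‖ - K * m ^ 3)]
  -- The shift `2B` makes the energy control both `a / 2` and `|c Q| / 2`, so its derivative is at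
  -- most `C₂` times itself.
  have hd : ∀ s ∈ uIcc 0 z, HasDerivWithinAt (fun s => a s - c s * Q s / 2 + 2 * B)
      (C₂ * (c s * Q s) / 2) (uIcc 0 z) s := by
    intro s hs
    have h1 := hasDerivWithinAt_norm_weakDeriv_sq (hy s hs)
    have h2 := hasDerivWithinAt_quartic (hasDerivWithinAt_ofH1_of_interaction (hy s hs))
      (continuousWithinAt_schr (hy s hs).continuousWithinAt)
    have h3 := (h1.sub (((hasDerivAt_nlsCoeff C₁ C₂ s).hasDerivWithinAt.mul h2).div_const 2)).add_const
      (2 * B)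
    refine h3.congr_deriv ?_
    simp only [c, Q]
    ring
  have hle : ∀ s ∈ uIcc 0 z, a s / 2 ≤ a s - c s * Q s / 2 + B := fun s hs => by
    have := (abs_le.1 (hpot s hs)).2
    linarith
  have h := le_mul_exp_of_abs_deriv_le (K := C₂) hd (fun s hs => by
    rw [mul_div_assoc, abs_mul, abs_of_pos hC₂]
    refine mul_le_mul_of_nonneg_left ?_ hC₂.le
    rw [abs_div, abs_two]
    have h1 := hpot s hs
    have h2 := hle s hs
    linarith)
  have h4 := hle z right_mem_uIcc
  have h5 : a 0 - c 0 * Q 0 / 2 + 2 * B ≤ 3 / 2 * ‖φ.weakDeriv‖ ^ 2 + 3 * B := by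
    have h6 := (abs_le.1 (hpot 0 left_mem_uIcc)).1
    have h7 : a 0 = ‖φ.weakDeriv‖ ^ 2 := by simp only [a, h0]
    linarith
  have h8 : Real.exp (C₂ * |z|) ≤ K := Real.exp_le_exp.2 (mul_le_mul_of_nonneg_left hz hC₂.le)
  have h9 : (a 0 - c 0 * Q 0 / 2 + 2 * B) * Real.exp (C₂ * |z|) ≤
      (3 / 2 * ‖φ.weakDeriv‖ ^ 2 + 3 * B) * K := by gcongr
  have h10 : ‖(y z).toL2‖ ^ 2 ≤ m ^ 2 :=
    pow_le_pow_left₀ (norm_nonneg _) (hmass z right_mem_uIcc) 2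
  rw [norm_sq_eq, aprioriBound]
  have h11 : ‖(y z).weakDeriv‖ ^ 2 = a z := rfl
  rw [h11]
  simp only [B] at *
  nlinarith

/-! ### Truncation and existence on bounded intervals -/

/-- A continuity argument: a continuous function which is strictly below `R` as long as it has not
exceeded `R` never reaches `R`. -/
theorem lt_of_forall_le_imp_lt {f : ℝ → ℝ} {z R : ℝ} (hf : ContinuousOn f (uIcc 0 z))
    (h0 : f 0 < R)
    (h : ∀ x ∈ uIcc 0 z, (∀ s ∈ uIcc 0 x, f s ≤ R) → f x < R) : f z < R := by
  have key : ∀ {g : ℝ → ℝ}, ContinuousOn g (Icc 0 1) → g 0 < R →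
      (∀ x ∈ Icc (0 : ℝ) 1, (∀ s ∈ Icc 0 x, g s ≤ R) → g x < R) → g 1 < R := by
    intro g hg hg0 hgx
    by_contra hlt
    push Not at hlt
    have hS : IsCompact {x ∈ Icc (0 : ℝ) 1 | g x = R} := by
      have : IsClosed (Icc (0 : ℝ) 1 ∩ g ⁻¹' {R}) :=
        hg.preimage_isClosed_of_isClosed isClosed_Icc isClosed_singleton
      exact isCompact_Icc.of_isClosed_subset this fun x hx => hx.1
    have hne : {x ∈ Icc (0 : ℝ) 1 | g x = R}.Nonempty := by
      obtain ⟨x, hx, hxR⟩ := intermediate_value_Icc zero_le_one hg ⟨hg0.le, hlt⟩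
      exact ⟨x, hx, hxR⟩
    -- At the first time `τ` with value `R`, the function has not exceeded `R` on `[0, τ]`, so the
    -- hypothesis contradicts `g τ = R`.
    obtain ⟨τ, ⟨hτ, hτR⟩, hmin⟩ := hS.exists_isLeast hne
    have hle : ∀ s ∈ Icc 0 τ, g s ≤ R := by
      intro s hs
      by_contra hcon
      push Not at hcon
      obtain ⟨x, hx, hxR⟩ := intermediate_value_Icc hs.1
        (hg.mono (Icc_subset_Icc le_rfl (hs.2.trans hτ.2))) ⟨hg0.le, hcon.le⟩
      have h1 : τ ≤ x := hmin ⟨⟨hx.1, (hx.2.trans hs.2).trans hτ.2⟩, hxR⟩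
      have h2 : x = s := le_antisymm hx.2 (hs.2.trans h1)
      rw [h2] at hxR
      exact hcon.ne' hxR
    exact (hgx τ hτ hle).ne hτR
  -- Rescaling by `z` treats both signs of `z` at once.
  have himg : ∀ x : ℝ, 0 ≤ x → uIcc 0 (x * z) = (fun s => s * z) '' Icc 0 x := fun x hx => by
    rw [← uIcc_of_le hx, image_mul_const_uIcc, zero_mul]
  have hmem : ∀ x ∈ Icc (0 : ℝ) 1, x * z ∈ uIcc 0 z := fun x hx => by
    have := himg 1 zero_le_one
    rw [one_mul] at this
    rw [this]
    exact ⟨x, hx, rfl⟩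
  have := key (g := fun τ => f (τ * z)) (hf.comp (by fun_prop) hmem) (by simpa using h0)
    (fun x hx hs => h _ (hmem x hx) fun s hs' => by
      rw [himg x hx.1] at hs'
      obtain ⟨σ, hσ, rfl⟩ := hs'
      exact hs σ hσ)
  simpa using this

section Retraction

variable {E : Type*} [NormedAddCommGroup E] [NormedSpace ℝ E]

/-- The radial retraction onto the closed ball of radius `R`. -/
def radialRetraction (R : ℝ) (u : E) : E := (R / max R ‖u‖) • u

theorem norm_radialRetraction_le {R : ℝ} (hR : 0 < R) (u : E) : ‖radialRetraction R u‖ ≤ R := by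
  have hM : 0 < max R ‖u‖ := hR.trans_le (le_max_left _ _)
  rw [radialRetraction, norm_smul, Real.norm_of_nonneg (by positivity), div_mul_eq_mul_div,
    div_le_iff₀ hM]
  exact mul_le_mul_of_nonneg_left (le_max_right _ _) hR.le

theorem radialRetraction_of_norm_le {R : ℝ} (hR : 0 < R) {u : E} (hu : ‖u‖ ≤ R) :
    radialRetraction R u = u := by
  rw [radialRetraction, max_eq_left hu, div_self hR.ne', one_smul]

/-- The change of the vector and the change of the scaling factor each contribute at most `‖u - v‖`.
-/
theorem norm_radialRetraction_sub_le {R : ℝ} (hR : 0 < R) (u v : E) :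
    ‖radialRetraction R u - radialRetraction R v‖ ≤ 2 * ‖u - v‖ := by
  have hM : 0 < max R ‖u‖ := hR.trans_le (le_max_left _ _)
  have hN : 0 < max R ‖v‖ := hR.trans_le (le_max_left _ _)
  have e : radialRetraction R u - radialRetraction R v =
      (R / max R ‖u‖) • (u - v) + (R / max R ‖u‖ - R / max R ‖v‖) • v := by
    rw [radialRetraction, radialRetraction, smul_sub, sub_smul]; abel
  have h1 : R / max R ‖u‖ ≤ 1 := (div_le_one hM).2 (le_max_left _ _)
  have h2 : ‖v‖ / max R ‖v‖ ≤ 1 := (div_le_one hN).2 (le_max_right _ _)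
  have h3 : |max R ‖v‖ - max R ‖u‖| ≤ ‖u - v‖ := by
    have := abs_max_sub_max_le_abs ‖v‖ ‖u‖ R
    rw [max_comm R, max_comm R]
    exact this.trans ((abs_norm_sub_norm_le v u).trans (norm_sub_rev v u).le)
  have h4 : |R / max R ‖u‖ - R / max R ‖v‖| * ‖v‖ =
      R / max R ‖u‖ * |max R ‖v‖ - max R ‖u‖| * (‖v‖ / max R ‖v‖) := by
    have : R / max R ‖u‖ - R / max R ‖v‖ =
        R / max R ‖u‖ * (max R ‖v‖ - max R ‖u‖) / max R ‖v‖ := by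
      field_simp
    rw [this, abs_div, abs_mul, abs_of_pos hN, abs_of_pos (div_pos hR hM)]
    ring
  rw [e]
  refine (norm_add_le _ _).trans ?_
  rw [norm_smul, norm_smul, Real.norm_eq_abs, Real.norm_eq_abs, h4, abs_of_pos (div_pos hR hM)]
  calc _ ≤ 1 * ‖u - v‖ + 1 * ‖u - v‖ * 1 := by gcongr
    _ = _ := by ring

theorem continuous_radialRetraction {R : ℝ} (hR : 0 < R) :
    Continuous (radialRetraction R : E → E) := by
  unfold radialRetraction
  refine Continuous.smul (continuous_const.div (continuous_const.max continuous_norm) fun u => ?_)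
    continuous_id
  exact (hR.trans_le (le_max_left _ _)).ne'

end Retraction

/-- The interaction-picture vector field with the nonlinearity truncated outside a ball. -/
def truncatedField (C₁ C₂ R z : ℝ) (y : H1R) : H1R :=
  schr (-z) ((Complex.I * nlsCoeff C₁ C₂ z) • cubic (radialRetraction R (schr z y)))

theorem truncatedField_eq {C₁ C₂ R z : ℝ} (hR : 0 < R) {y : H1R} (hy : ‖y‖ ≤ R) :
    truncatedField C₁ C₂ R z y = interactionField C₁ C₂ z y := by
  rw [truncatedField, radialRetraction_of_norm_le hR (by rwa [LinearIsometry.norm_map]),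
    interactionField]

/-- The truncated field is bounded and globally Lipschitz in `y`, so Picard–Lindelöf requires no
smallness of `T`: a ball of radius (field bound) × `T` contains the whole trajectory. -/
theorem exists_truncated_solution {C₁ C₂ R T : ℝ} (hC₁ : C₁ = 1 ∨ C₁ = -1) (hC₂ : 0 < C₂)
    (hR : 0 < R) (hT : 0 ≤ T) (φ : H1R) : ∃ y : ℝ → H1R, y 0 = φ ∧ ∀ s ∈ Icc (-T) T,
      HasDerivWithinAt y (truncatedField C₁ C₂ R s (y s)) (Icc (-T) T) s := by
  set K := Real.exp (C₂ * T)
  have hK : 0 < K := Real.exp_pos _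
  have hc : ∀ z ∈ Icc (-T) T, ‖Complex.I * (nlsCoeff C₁ C₂ z : ℂ)‖ ≤ K := fun z hz => by
    rw [norm_mul, Complex.norm_I, one_mul, Complex.norm_real, Real.norm_eq_abs]
    exact abs_nlsCoeff_le hC₁ hC₂ (abs_le.2 hz)
  let L : NNReal := ⟨K * (9 * R ^ 3), by positivity⟩
  let Λ : NNReal := ⟨K * (27 * R ^ 2) * 2, by positivity⟩
  let A : NNReal := ⟨K * (9 * R ^ 3) * T, by positivity⟩
  have hpl : IsPicardLindelof (truncatedField C₁ C₂ R)
      (⟨0, by constructor <;> linarith⟩ : Icc (-T) T) φ A 0 L Λ := by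
    refine ⟨fun z hz => LipschitzOnWith.of_dist_le_mul fun u _ v _ => ?_, fun u _ => ?_,
      fun z hz u _ => ?_, ?_⟩
    · rw [dist_eq_norm, dist_eq_norm, truncatedField, truncatedField, ← map_sub,
        LinearIsometry.norm_map, ← smul_sub, norm_smul]
      have h1 := norm_radialRetraction_sub_le hR (schr z u) (schr z v)
      rw [← map_sub, LinearIsometry.norm_map] at h1
      have h2 := norm_cubic_sub_le (norm_radialRetraction_le hR (schr z u))
        (norm_radialRetraction_le hR (schr z v))
      calc _ ≤ K * (27 * R ^ 2 * ‖radialRetraction R (schr z u) - radialRetraction R (schr z v)‖) :=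
            mul_le_mul (hc z hz) h2 (norm_nonneg _) hK.le
        _ ≤ K * (27 * R ^ 2 * (2 * ‖u - v‖)) := by gcongr
        _ = K * (27 * R ^ 2) * 2 * ‖u - v‖ := by ring
    · have h1 : Continuous fun z => (Complex.I * (nlsCoeff C₁ C₂ z : ℂ)) •
          cubic (radialRetraction R (schr z u)) :=
        (continuous_const.mul (Complex.continuous_ofReal.comp (continuous_nlsCoeff C₁ C₂))).smul
          (continuous_cubic.comp ((continuous_radialRetraction hR).comp (continuous_schr u)))
      refine (continuous_iff_continuousAt.2 fun z => ?_).continuousOn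
      exact tendsto_schr (continuous_neg.tendsto z) (h1.tendsto z)
    · rw [truncatedField, LinearIsometry.norm_map, norm_smul]
      exact mul_le_mul (hc z hz) (norm_cubic_le (norm_radialRetraction_le hR _)) (norm_nonneg _)
        hK.le
    · change K * (9 * R ^ 3) * max (T - 0) (0 - -T) ≤ K * (9 * R ^ 3) * T - 0
      simp
  exact hpl.exists_eq_forall_mem_Icc_hasDerivWithinAt₀

theorem exists_isH1Solution_Icc {C₁ C₂ T : ℝ} (hC₁ : C₁ = 1 ∨ C₁ = -1) (hC₂ : 0 < C₂)
    (hT : 0 ≤ T) (φ : H1R) : ∃ v : ℝ → H1R, IsH1Solution C₁ C₂ φ (Icc (-T) T) v := by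
  -- The a priori bound does not depend on `R`. The added terms place both that bound and the
  -- initial value strictly inside the ball.
  set R := √(aprioriBound C₂ φ T) + ‖φ‖ + 1
  have hR : 0 < R := by positivity
  obtain ⟨y, h0, hy⟩ := exists_truncated_solution hC₁ hC₂ hR hT φ
  have h0T : (0 : ℝ) ∈ Icc (-T) T := ⟨by linarith, hT⟩
  have hsub : ∀ z ∈ Icc (-T) T, uIcc 0 z ⊆ Icc (-T) T := fun z hz =>
    ordConnected_Icc.uIcc_subset h0T hz
  have hbound : ∀ z ∈ Icc (-T) T, ‖y z‖ < R := by
    intro z hz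
    refine lt_of_forall_le_imp_lt (f := fun s => ‖y s‖) (z := z)
      (fun s hs => ((hy s (hsub z hz hs)).continuousWithinAt.mono (hsub z hz)).norm) ?_ ?_
    · simp only [h0, R]
      linarith [Real.sqrt_nonneg (aprioriBound C₂ φ T)]
    · intro x hx hle
      have hxT := hsub z hz hx
      -- Up to `x` the truncation is inactive, so the a priori bound applies.
      have h1 := norm_sq_le_aprioriBound hC₁ hC₂ (abs_le.2 hxT) h0 fun s hs => by
        rw [← truncatedField_eq hR (hle s hs)]
        exact (hy s (hsub x hxT hs)).mono (hsub x hxT)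
      have h2 := Real.le_sqrt_of_sq_le h1
      simp only [R]
      linarith [norm_nonneg φ]
  exact ⟨_, isH1Solution_of_interaction h0 fun s hs => by
    rw [← truncatedField_eq hR (hbound s hs).le]
    exact hy s hs⟩

/-! ### Gluing to a global solution -/

/-- Global existence. -/
theorem exists_isH1Solution_univ {C₁ C₂ : ℝ} (hC₁ : C₁ = 1 ∨ C₁ = -1) (hC₂ : 0 < C₂)
    (φ : H1R) : ∃ v : ℝ → H1R, IsH1Solution C₁ C₂ φ univ v := by
  choose w hw using fun n : ℕ => exists_isH1Solution_Icc hC₁ hC₂ (Nat.cast_nonneg n : (0 : ℝ) ≤ n) φ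
  set k : ℝ → ℕ := fun z => ⌈|z|⌉₊
  have hk : ∀ z, |z| ≤ k z := fun z => Nat.le_ceil _
  -- Uniqueness on the smaller of the two intervals makes the glued value independent of the choice
  -- of `n`.
  have heq : ∀ (n : ℕ) (z : ℝ), |z| ≤ n → w (k z) z = w n z := by
    intro n z hz
    have hsub : ∀ m : ℕ, min (k z) n ≤ m →
        Icc (-((min (k z) n : ℕ) : ℝ)) ((min (k z) n : ℕ) : ℝ) ⊆ Icc (-(m : ℝ)) m := fun m hm => by
      have : ((min (k z) n : ℕ) : ℝ) ≤ m := by exact_mod_cast hm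
      exact Icc_subset_Icc (by linarith) this
    refine IsH1Solution.eqOn hC₁ hC₂ ordConnected_Icc
      (⟨by simp, by simp⟩ : (0 : ℝ) ∈ Icc (-((min (k z) n : ℕ) : ℝ)) ((min (k z) n : ℕ) : ℝ))
      ((hw (k z)).mono (hsub _ (min_le_left _ _))) ((hw n).mono (hsub _ (min_le_right _ _)))
      (abs_le.1 ?_)
    rw [Nat.cast_min]
    exact le_min (hk z) hz
  refine ⟨fun z => w (k z) z, isH1Solution_iff.2 ⟨?_, ?_, ?_⟩⟩
  · refine (continuous_iff_continuousAt.2 fun z => ?_).continuousOn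
    obtain ⟨n, hn⟩ := exists_nat_gt |z|
    have hnhds : Icc (-(n : ℝ)) n ∈ 𝓝 z := Icc_mem_nhds (abs_lt.1 hn).1 (abs_lt.1 hn).2
    refine ((hw n).continuousOn.continuousAt hnhds).congr ?_
    filter_upwards [hnhds] with x hx
    exact (heq n x (abs_le.2 hx)).symm
  · exact (hw _).initial
  · intro z _
    -- Strict inequality makes `[-n, n]` a neighbourhood of `z`, so the derivative within it is a
    -- full derivative.
    obtain ⟨n, hn⟩ := exists_nat_gt |z|
    have hnhds : Icc (-(n : ℝ)) n ∈ 𝓝 z := Icc_mem_nhds (abs_lt.1 hn).1 (abs_lt.1 hn).2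
    have h := ((isH1Solution_iff.1 (hw n)).2.2 z (abs_le.1 hn.le)).hasDerivAt hnhds
    rw [heq n z hn.le]
    refine (h.congr_of_eventuallyEq ?_).hasDerivWithinAt
    filter_upwards [hnhds] with x hx
    rw [heq n x (abs_le.2 hx)]

end

theorem proposition2p7 (C₁ C₂ : ℝ) (hC₁ : C₁ = 1 ∨ C₁ = -1) (hC₂ : 0 < C₂) (φ : H1R) :
    ∃ v : ℝ → H1R, IsH1Solution C₁ C₂ φ Set.univ v ∧
      ∀ (I : Set ℝ), I.OrdConnected → (0 : ℝ) ∈ I →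
        ∀ w : ℝ → H1R, IsH1Solution C₁ C₂ φ I w → Set.EqOn w v I := by
  obtain ⟨v, hv⟩ := exists_isH1Solution_univ hC₁ hC₂ φ
  exact ⟨v, hv, fun I hI h0 w hw => hw.eqOn hC₁ hC₂ hI h0 (hv.mono (subset_univ I))⟩
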